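/- Let $d\in\mathbb{N}$, let $\mathcal{A}$ be a finite non-empty set and let $\Phi=\{\phi_a(x)=\frac{x+\mathfrak{p}_a}{q_a}\}_{a\in\mathcal{A}}$ be an iterated function system on $\mathbb{R}^d$ (with the Euclidean norm), where $\mathfrak{p}_a\in\mathbb{Z}^d$, $q_a\in\mathbb{Z}$ and $|q_a|\ge 2$. Let $X$ be its self-similar set, i.e. the unique non-empty compact set with $X=\bigcup_{a}\phi_a(X)$, and let $\pi:\mathcal{A}^{\mathbb{N}}\to X$, $\pi((a_n))=\lim_{n\to\infty}(\phi_{a_1}\circ\cdots\circ\phi_{a_n})(0)$. For a word $\mathbf{a}=(a_1,\ldots,a_n)\in\mathcal{A}^n$ let $X_{\mathbf{a}}=(\phi_{a_1}\circ\cdots\circ\phi_{a_n})(X)$. Assume the strong separation condition: $\phi_a(X)\cap\phi_{a'}(X)=\emptyset$ whenever $a\ne a'$. Let $r_a=1/|q_a|$, let $\dim_S(\Phi)$ be the unique $s$ with $\sum_a r_a^s=1$, let $\mathbf{p}=(p_a)_{a\in\mathcal{A}}$ with $p_a=r_a^{\dim_S(\Phi)}$, let $h_{\mathbf{p}}=-\sum_a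 p_a\log p_a$, and let $\mu$ be the self-similar measure of $\Phi$ with weights $\mathbf{p}$, i.e. the image under $\pi$ of the Bernoulli measure on $\mathcal{A}^{\mathbb{N}}$ with weights $\mathbf{p}$ (equivalently, the unique Borel probability measure with $\mu=\sum_a p_a\,\phi_a\mu$). Every $y\in X\cap\mathbb{Q}^d$ can be written as $y=\pi(a_1\ldots a_l(a_{l+1}\ldots a_n)^\infty)$ with $n\ge 1$ and $0\le l\le n-1$. Let $n(y)$ be the least $n$ that occurs in such a representation, and let the intrinsic denominator $q_{int}(y)$ be the least value of $$\Big|\prod_{j=1}^{l}q_{a_j}\cdot\Big(\prod_{j=l+1}^{n}q_{a_j}-1\Big)\Big|$$ over all such representations of $y$. For $g:\mathbb{N}\to[0,\infty)$, where $\mathbb{N}=\{1,2,\ldots\}$, let $$W_{\Phi}^{***}(g)=\Big\{x\in X:\ \|x-y\|<\frac{g(n(y))}{q_{int}(y)}\ \text{ for infinitely many } y\in X\cap\mathbb{Q}^d\Big\}.$$ Then the following statements are true (with the convention $0^0=1$). 1. For any $s\ge 0$, if $\sum_{n=1}^{\infty}\sum_{\mathbf{a}\in\mathcal{A}^n}n\,(\mathrm{Diam}(X_{\mathbf{a}})\,g(n))^s<\infty$,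 then $\mathcal{H}^s(W_{\Phi}^{***}(g))=0$, where $\mathcal{H}^s$ is the $s$-dimensional Hausdorff measure. 2. If $g$ is non-increasing, $h_{\mathbf{p}}<-2\log\sum_{a\in\mathcal{A}}p_a^2$, and $\sum_{n=1}^{\infty}\sum_{\mathbf{a}\in\mathcal{A}^n}n\,(\mathrm{Diam}(X_{\mathbf{a}})\,g(n))^{\dim_S(\Phi)}=\infty$, then $\mu(W_{\Phi}^{***}(g))=1$. -/

import Mathlib

open MeasureTheory Filter Topology
open scoped NNReal ENNReal

/-- An iterated function system `{x ↦ (x + 𝔭_a) / q_a}` on `ℝ^d`, indexed by `A`, with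
`𝔭_a ∈ ℤ^d`, `q_a ∈ ℤ` and `|q_a| ≥ 2`. -/
structure RationalIFS (A : Type*) (d : ℕ) where
  p : A → Fin d → ℤ
  q : A → ℤ
  two_le_abs_q : ∀ a, 2 ≤ |q a|

namespace RationalIFS

variable {A : Type*} {d : ℕ} (Φ : RationalIFS A d)

/-- The similarity `φ_a(x) = (x + 𝔭_a) / q_a`. -/
noncomputable def map (a : A) (x : EuclideanSpace ℝ (Fin d)) : EuclideanSpace ℝ (Fin d) :=
  (Φ.q a : ℝ)⁻¹ • (x + WithLp.toLp 2 (fun i => (Φ.p a i : ℝ)))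

/-- The contraction ratio `r_a = 1 / |q_a|` of `φ_a`. -/
noncomputable def ratio (a : A) : ℝ := |(Φ.q a : ℝ)|⁻¹

/-- `φ_w = φ_{w_1} ∘ ⋯ ∘ φ_{w_n}` for a finite word `w` of length `n`. -/
noncomputable def wordMap {n : ℕ} (w : Fin n → A) (x : EuclideanSpace ℝ (Fin d)) :
    EuclideanSpace ℝ (Fin d) :=
  (List.ofFn w).foldr Φ.map x

/-- The projection map `π : A^ℕ → ℝ^d`, `π(a) = lim_n (φ_{a_1} ∘ ⋯ ∘ φ_{a_n})(0)`
(sequences are indexed from `0`). -/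
noncomputable def coding (a : ℕ → A) : EuclideanSpace ℝ (Fin d) :=
  limUnder atTop fun n : ℕ => Φ.wordMap (fun i : Fin n => a i) 0

/-- The self-similar set `X = π(A^ℕ)`. The lemmas below show that, for finite non-empty `A`, it is
the unique non-empty compact set with `X = ⋃ a, φ_a(X)`. -/
def selfSimilarSet : Set (EuclideanSpace ℝ (Fin d)) := Set.range Φ.coding

/-- The strong separation condition: the sets `φ_a(X)` are pairwise disjoint. -/
def StrongSeparation : Prop :=
  Pairwise fun a b => Disjoint (Φ.map a '' Φ.selfSimilarSet) (Φ.map b '' Φ.selfSimilarSet)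

/-! ### The projection map and the self-similar set -/

lemma ratio_pos (a : A) : 0 < Φ.ratio a := by
  have h : (2 : ℝ) ≤ |(Φ.q a : ℝ)| := by exact_mod_cast Φ.two_le_abs_q a
  unfold ratio
  positivity

lemma ratio_le_half (a : A) : Φ.ratio a ≤ 1 / 2 := by
  have h : (2 : ℝ) ≤ |(Φ.q a : ℝ)| := by exact_mod_cast Φ.two_le_abs_q a
  unfold ratio
  rw [one_div]
  exact inv_anti₀ (by norm_num) h

lemma dist_map (a : A) (x y : EuclideanSpace ℝ (Fin d)) :
    dist (Φ.map a x) (Φ.map a y) = Φ.ratio a * dist x y := by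
  simp [map, ratio, dist_smul₀]

lemma continuous_map (a : A) : Continuous (Φ.map a) := by
  unfold map
  fun_prop

lemma dist_wordMap_le {n : ℕ} (w : Fin n → A) (x y : EuclideanSpace ℝ (Fin d)) :
    dist (Φ.wordMap w x) (Φ.wordMap w y) ≤ (1 / 2) ^ n * dist x y := by
  induction n with
  | zero => simp [wordMap]
  | succ n ih =>
    have h := ih (fun i => w i.succ)
    have h' : dist (Φ.wordMap w x) (Φ.wordMap w y) = Φ.ratio (w 0) *
        dist (Φ.wordMap (fun i => w i.succ) x) (Φ.wordMap (fun i => w i.succ) y) := by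
      simp only [wordMap, List.ofFn_succ, List.foldr_cons, dist_map]
    rw [h', pow_succ', mul_assoc]
    exact mul_le_mul (Φ.ratio_le_half _) h dist_nonneg (by norm_num)

lemma wordMap_prefix_succ (a : ℕ → A) (n : ℕ) (x : EuclideanSpace ℝ (Fin d)) :
    Φ.wordMap (fun i : Fin (n + 1) => a i) x
      = Φ.map (a 0) (Φ.wordMap (fun i : Fin n => a (i + 1)) x) := by
  simp [wordMap, List.ofFn_succ]

lemma wordMap_prefix_succ' (a : ℕ → A) (n : ℕ) (x : EuclideanSpace ℝ (Fin d)) :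
    Φ.wordMap (fun i : Fin (n + 1) => a i) x
      = Φ.wordMap (fun i : Fin n => a i) (Φ.map (a n) x) := by
  simp only [wordMap, List.ofFn_succ_last, List.foldr_append, List.foldr_cons, List.foldr_nil,
    Fin.val_castSucc, Fin.val_last]

lemma exists_bound [Finite A] : ∃ C : ℝ, ∀ a, dist 0 (Φ.map a 0) ≤ C := by
  cases nonempty_fintype A
  exact ⟨∑ b, dist 0 (Φ.map b 0), fun a =>
    Finset.single_le_sum (f := fun b => dist 0 (Φ.map b 0)) (fun _ _ => dist_nonneg)
      (Finset.mem_univ a)⟩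

lemma dist_prefix_le {C : ℝ} (hC : ∀ a, dist 0 (Φ.map a 0) ≤ C) (a : ℕ → A) (n : ℕ) :
    dist (Φ.wordMap (fun i : Fin n => a i) 0) (Φ.wordMap (fun i : Fin (n + 1) => a i) 0)
      ≤ C * (1 / 2) ^ n := by
  rw [wordMap_prefix_succ', mul_comm]
  exact (Φ.dist_wordMap_le _ _ _).trans (mul_le_mul_of_nonneg_left (hC _) (by positivity))

/-- The limit defining `π` exists. -/
lemma tendsto_coding [Finite A] (a : ℕ → A) :
    Tendsto (fun n : ℕ => Φ.wordMap (fun i : Fin n => a i) 0) atTop (𝓝 (Φ.coding a)) := by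
  obtain ⟨C, hC⟩ := Φ.exists_bound
  exact (cauchySeq_of_le_geometric (1 / 2) C (by norm_num)
    (Φ.dist_prefix_le hC a)).tendsto_limUnder

/-- The starting point in the definition of `π` does not matter. -/
lemma tendsto_coding_of_bounded [Finite A] (a : ℕ → A) (x : ℕ → EuclideanSpace ℝ (Fin d)) (D : ℝ)
    (hx : ∀ n, dist (x n) 0 ≤ D) :
    Tendsto (fun n : ℕ => Φ.wordMap (fun i : Fin n => a i) (x n)) atTop (𝓝 (Φ.coding a)) := by
  refine (Φ.tendsto_coding a).congr_dist ?_
  have h0 : Tendsto (fun n : ℕ => ((1 : ℝ) / 2) ^ n * D) atTop (𝓝 0) := by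
    simpa using (tendsto_pow_atTop_nhds_zero_of_lt_one (by norm_num : (0 : ℝ) ≤ 1 / 2)
      (by norm_num)).mul_const D
  refine squeeze_zero (fun _ => dist_nonneg) (fun n => ?_) h0
  refine (Φ.dist_wordMap_le _ _ _).trans (mul_le_mul_of_nonneg_left ?_ (by positivity))
  rw [dist_comm]
  exact hx n

lemma coding_eq [Finite A] (a : ℕ → A) :
    Φ.coding a = Φ.map (a 0) (Φ.coding fun n => a (n + 1)) := by
  have h1 := (Φ.tendsto_coding a).comp (tendsto_add_atTop_nat 1)
  have h2 := ((Φ.continuous_map (a 0)).tendsto _).comp (Φ.tendsto_coding fun n => a (n + 1))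
  refine tendsto_nhds_unique h1 (h2.congr fun n => ?_)
  simp only [Function.comp_apply]
  exact (Φ.wordMap_prefix_succ a n 0).symm

lemma continuous_coding [Finite A] [TopologicalSpace A] [DiscreteTopology A] :
    Continuous Φ.coding := by
  obtain ⟨C, hC⟩ := Φ.exists_bound
  have hu : TendstoUniformly (fun (n : ℕ) (a : ℕ → A) => Φ.wordMap (fun i : Fin n => a i) 0)
      Φ.coding atTop := by
    rw [Metric.tendstoUniformly_iff]
    intro ε hε
    have h0 : Tendsto (fun n : ℕ => C * ((1 : ℝ) / 2) ^ n / (1 - 1 / 2)) atTop (𝓝 0) := by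
      simpa using ((tendsto_pow_atTop_nhds_zero_of_lt_one (by norm_num : (0 : ℝ) ≤ 1 / 2)
        (by norm_num)).const_mul C).div_const (1 - 1 / 2)
    filter_upwards [h0.eventually (gt_mem_nhds hε)] with n hn a
    rw [dist_comm]
    exact (dist_le_of_le_geometric_of_tendsto (1 / 2) C (by norm_num)
      (Φ.dist_prefix_le hC a) (Φ.tendsto_coding a) n).trans_lt hn
  refine hu.continuous (Eventually.frequently (Eventually.of_forall fun n => ?_))
  have h1 : Continuous fun w : Fin n → A => Φ.wordMap w (0 : EuclideanSpace ℝ (Fin d)) :=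
    continuous_of_discreteTopology
  exact h1.comp (continuous_pi fun i => continuous_apply (i : ℕ))

lemma measurable_coding [Finite A] :
    @Measurable _ _ (@MeasurableSpace.pi ℕ (fun _ => A) fun _ => ⊤) _ Φ.coding := by
  let : MeasurableSpace A := ⊤
  let : TopologicalSpace A := ⊥
  have : DiscreteTopology A := ⟨rfl⟩
  have : BorelSpace A := ⟨borel_eq_top_of_discrete.symm⟩
  exact Φ.continuous_coding.measurable

lemma selfSimilarSet_nonempty [Nonempty A] : Φ.selfSimilarSet.Nonempty :=
  Set.range_nonempty _

lemma isCompact_selfSimilarSet [Finite A] : IsCompact Φ.selfSimilarSet := by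
  let : TopologicalSpace A := ⊥
  have : DiscreteTopology A := ⟨rfl⟩
  exact isCompact_range Φ.continuous_coding

lemma selfSimilarSet_eq [Finite A] :
    Φ.selfSimilarSet = ⋃ a, Φ.map a '' Φ.selfSimilarSet := by
  ext x
  simp only [Set.mem_iUnion]
  constructor
  · rintro ⟨a, rfl⟩
    exact ⟨a 0, _, ⟨fun n => a (n + 1), rfl⟩, (Φ.coding_eq a).symm⟩
  · rintro ⟨b, _, ⟨a, rfl⟩, rfl⟩
    exact ⟨fun n => Nat.casesOn n b a, Φ.coding_eq _⟩

/-- Uniqueness of the self-similar set. -/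
lemma eq_selfSimilarSet [Finite A] {K : Set (EuclideanSpace ℝ (Fin d))} (hne : K.Nonempty)
    (hK : IsCompact K) (h : K = ⋃ a, Φ.map a '' K) : K = Φ.selfSimilarSet := by
  obtain ⟨D, hD⟩ := hK.isBounded.subset_closedBall 0
  have hmaps : ∀ n (w : Fin n → A), ∀ x ∈ K, Φ.wordMap w x ∈ K := by
    intro n w x hx
    unfold wordMap
    induction List.ofFn w with
    | nil => simpa using hx
    | cons b l ih =>
      rw [h]
      exact Set.mem_iUnion.2 ⟨b, _, ih, rfl⟩
  apply Set.Subset.antisymm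
  · intro x hx
    have hex : ∀ y : K, ∃ (b : A) (z : K), Φ.map b z = y := by
      rintro ⟨y, hy⟩
      rw [h] at hy
      obtain ⟨b, z, hz, hzy⟩ := Set.mem_iUnion.1 hy
      exact ⟨b, ⟨z, hz⟩, hzy⟩
    choose b z hbz using hex
    let y : ℕ → K := fun n => z^[n] ⟨x, hx⟩
    have hy : ∀ n, Φ.wordMap (fun i : Fin n => b (y i)) (y n) = x := by
      intro n
      induction n with
      | zero => simp [wordMap, y]
      | succ n ih =>
        rw [Φ.wordMap_prefix_succ' (fun i => b (y i))]
        have hs : y (n + 1) = z (y n) := Function.iterate_succ_apply' z n _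
        rw [hs, hbz]
        exact ih
    have ht := Φ.tendsto_coding_of_bounded (fun i => b (y i)) (fun n => y n) D
      (fun n => hD (y n).2)
    simp only [hy] at ht
    exact ⟨_, tendsto_nhds_unique ht tendsto_const_nhds⟩
  · rintro _ ⟨a, rfl⟩
    obtain ⟨x, hx⟩ := hne
    exact hK.isClosed.mem_of_tendsto
      (Φ.tendsto_coding_of_bounded a (fun _ => x) D (fun _ => hD hx))
      (Eventually.of_forall fun n => hmaps n _ x hx)

/-! ### The similarity dimension and the self-similar measure -/

section Measure

variable [Fintype A] [Nonempty A]

lemma existsUnique_similarityDim : ∃! s : ℝ, ∑ a, Φ.ratio a ^ s = 1 := by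
  have hr0 := Φ.ratio_pos
  have hr1 : ∀ a, Φ.ratio a < 1 := fun a => (Φ.ratio_le_half a).trans_lt (by norm_num)
  have hanti : StrictAnti fun s : ℝ => ∑ a, Φ.ratio a ^ s := by
    intro s t hst
    exact Finset.sum_lt_sum_of_nonempty Finset.univ_nonempty fun a _ =>
      Real.rpow_lt_rpow_of_exponent_gt (hr0 a) (hr1 a) hst
  have hcont : Continuous fun s : ℝ => ∑ a, Φ.ratio a ^ s :=
    continuous_finsetSum _ fun a _ => Real.continuous_const_rpow (hr0 a).ne'
  have hlim : Tendsto (fun s : ℝ => ∑ a, Φ.ratio a ^ s) atTop (𝓝 0) := by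
    simpa using tendsto_finsetSum Finset.univ fun a _ =>
      tendsto_rpow_atTop_of_base_lt_one (Φ.ratio a) (by linarith [hr0 a]) (hr1 a)
  obtain ⟨t, ht, ht0⟩ := ((hlim.eventually (gt_mem_nhds one_pos)).and (eventually_ge_atTop 0)).exists
  have h0 : (1 : ℝ) ≤ ∑ a, Φ.ratio a ^ (0 : ℝ) := by
    simp only [Real.rpow_zero, Finset.sum_const, Finset.card_univ, nsmul_eq_mul, mul_one]
    exact_mod_cast Fintype.card_pos
  obtain ⟨s, -, hs⟩ := intermediate_value_Icc' ht0 hcont.continuousOn ⟨ht.le, h0⟩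
  exact ⟨s, hs, fun s' hs' => hanti.injective (hs'.trans hs.symm)⟩

/-- The similarity dimension `dim_S(Φ)`: the unique `s` with `∑ a, r_a ^ s = 1`. -/
noncomputable def similarityDim : ℝ := Φ.existsUnique_similarityDim.choose

/-- The probability vector `p_a = r_a ^ dim_S(Φ)`. -/
noncomputable def prob (a : A) : ℝ := Φ.ratio a ^ Φ.similarityDim

lemma prob_pos (a : A) : 0 < Φ.prob a := Real.rpow_pos_of_pos (Φ.ratio_pos a) _

lemma sum_prob : ∑ a, Φ.prob a = 1 := Φ.existsUnique_similarityDim.choose_spec.1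

/-- The entropy `h_p = -∑ a, p_a log p_a`. -/
noncomputable def entropy : ℝ := -∑ a, Φ.prob a * Real.log (Φ.prob a)

/-- The probability vector `(p_a)`, as a probability mass function. -/
noncomputable def probPMF : PMF A :=
  PMF.ofFintype (fun a => ENNReal.ofReal (Φ.prob a)) (by
    rw [← ENNReal.ofReal_sum_of_nonneg fun a _ => (Φ.prob_pos a).le, Φ.sum_prob,
      ENNReal.ofReal_one])

/-- The Bernoulli measure `𝔪` on `A^ℕ` with weights `(p_a)`; the finite alphabet carries the
discrete σ-algebra. -/
noncomputable def bernoulli : @Measure (ℕ → A) (@MeasurableSpace.pi ℕ (fun _ => A) fun _ => ⊤) :=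
  letI : MeasurableSpace A := ⊤
  Measure.infinitePi fun _ : ℕ => Φ.probPMF.toMeasure

/-- The self-similar measure `μ = π 𝔪`. -/
noncomputable def selfSimilarMeasure : Measure (EuclideanSpace ℝ (Fin d)) :=
  letI : MeasurableSpace A := ⊤
  Φ.bernoulli.map Φ.coding

instance : IsProbabilityMeasure Φ.selfSimilarMeasure := by
  let : MeasurableSpace A := ⊤
  have : IsProbabilityMeasure Φ.bernoulli :=
    inferInstanceAs (IsProbabilityMeasure (Measure.infinitePi fun _ : ℕ => Φ.probPMF.toMeasure))
  exact Measure.isProbabilityMeasure_map Φ.measurable_coding.aemeasurable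

/-- `μ` satisfies the self-similarity equation `μ = ∑ a, p_a • φ_a μ`. -/
lemma selfSimilarMeasure_eq :
    Φ.selfSimilarMeasure
      = ∑ a, ENNReal.ofReal (Φ.prob a) • Φ.selfSimilarMeasure.map (Φ.map a) := by
  let : MeasurableSpace A := ⊤
  have hB : Φ.bernoulli = Measure.infinitePi fun _ : ℕ => Φ.probPMF.toMeasure := rfl
  let c : A → (ℕ → A) → ℕ → A := fun b a n => Nat.casesOn n b a
  have hc : ∀ b, Measurable (c b) := fun b => by
    refine measurable_pi_lambda _ fun n => ?_
    cases n with
    | zero => exact measurable_const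
    | succ n => exact measurable_pi_apply n
  have key : Φ.bernoulli = ∑ b, ENNReal.ofReal (Φ.prob b) • Φ.bernoulli.map (c b) := by
    rw [hB]
    symm
    refine Measure.eq_infinitePi _ fun s t _ => ?_
    classical
    obtain ⟨N, hN⟩ := s.exists_nat_subset_range
    let t' : ℕ → Set A := fun i => if i ∈ s then t i else Set.univ
    have hs : s ⊆ Finset.range (N + 1) :=
      hN.trans (Finset.range_mono (Nat.le_succ N))
    have hset : (Set.pi (s : Set ℕ) t) = Set.pi (Finset.range (N + 1) : Set ℕ) t' := by
      ext a
      simp only [Set.mem_pi, Finset.mem_coe, t']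
      constructor
      · intro h i _
        split_ifs with his
        · exact h i his
        · trivial
      · intro h i his
        simpa [his] using h i (hs his)
    have hprod : ∏ i ∈ s, Φ.probPMF.toMeasure (t i)
        = ∏ i ∈ Finset.range (N + 1), Φ.probPMF.toMeasure (t' i) := by
      rw [← Finset.prod_subset hs fun i _ his => by simp [t', his]]
      exact Finset.prod_congr rfl fun i his => by simp [t', his]
    have hterm : ∀ b, (Measure.infinitePi fun _ : ℕ => Φ.probPMF.toMeasure).map (c b)
        (Set.pi (Finset.range (N + 1) : Set ℕ) t')
        = (t' 0).indicator 1 b * ∏ i ∈ Finset.range N, Φ.probPMF.toMeasure (t' (i + 1)) := by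
      intro b
      rw [Measure.map_apply (hc b)
        (MeasurableSet.pi (Finset.countable_toSet _) fun _ _ => trivial)]
      have hpre : c b ⁻¹' (Set.pi (Finset.range (N + 1) : Set ℕ) t')
          = {_a | b ∈ t' 0} ∩ Set.pi (Finset.range N : Set ℕ) (fun i => t' (i + 1)) := by
        ext a
        simp only [Set.mem_preimage, Set.mem_pi, Set.mem_inter_iff, Set.mem_ofPred_eq,
          Finset.mem_coe, Finset.mem_range]
        constructor
        · exact fun h => ⟨h 0 (Nat.succ_pos N), fun i hi => h (i + 1) (by omega)⟩
        · rintro ⟨h0, h⟩ i hi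
          cases i with
          | zero => exact h0
          | succ i => exact h i (by omega)
      rw [hpre]
      by_cases hb : b ∈ t' 0
      · have h1 := Measure.infinitePi_pi (fun _ : ℕ => Φ.probPMF.toMeasure)
          (s := Finset.range N) (t := fun i => t' (i + 1)) fun _ _ => trivial
        simp only [hb, Set.ofPred_true, Set.univ_inter, h1, Set.indicator_of_mem, Pi.one_apply,
          one_mul]
      · simp [hb]
    rw [hset, hprod, Measure.finsetSum_apply]
    simp only [Measure.smul_apply, hterm, smul_eq_mul]
    rw [Finset.prod_range_succ', mul_comm, PMF.toMeasure_apply_fintype, Finset.sum_mul]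
    refine Finset.sum_congr rfl fun b _ => ?_
    rw [← mul_assoc]
    congr 1
    by_cases hb : b ∈ t' 0 <;> simp [hb, probPMF]
  have hm : Measurable Φ.coding := Φ.measurable_coding
  unfold selfSimilarMeasure
  conv_lhs => rw [key]
  rw [← Measure.mapₗ_apply_of_measurable hm, map_sum]
  refine Finset.sum_congr rfl fun b _ => ?_
  rw [map_smul, Measure.mapₗ_apply_of_measurable hm, Measure.map_map hm (hc b),
    Measure.map_map (Φ.continuous_map b).measurable hm]
  congr 2
  ext1 a
  exact Φ.coding_eq _

end Measure

/-! ### Rational points of the self-similar set and intrinsic approximation -/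

/-- The sequence `w_1 ⋯ w_l (w_{l+1} ⋯ w_n)^∞` (indexed from `0`), where `0 ≤ l ≤ n - 1`. -/
def eventuallyPeriodic {n : ℕ} (w : Fin n → A) (l : Fin n) (i : ℕ) : A :=
  if h : i < l then w ⟨i, h.trans l.isLt⟩
  else w ⟨l + (i - l) % (n - l), by
    have h1 := l.isLt
    have h2 := Nat.mod_lt (i - l) (Nat.sub_pos_of_lt h1)
    omega⟩

/-- The absolute value of `∏_{j ≤ l} q_{w_j} * (∏_{l < j ≤ n} q_{w_j} - 1)`. -/
def denominator {n : ℕ} (w : Fin n → A) (l : Fin n) : ℕ :=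
  ((∏ j with j < l, Φ.q (w j)) * ((∏ j with l ≤ j, Φ.q (w j)) - 1)).natAbs

/-- The rational points of `X`, i.e. `X ∩ ℚ^d`. -/
def rationalPoints : Set (EuclideanSpace ℝ (Fin d)) :=
  {y | y ∈ Φ.selfSimilarSet ∧ ∀ i, ∃ r : ℚ, y i = r}

/-- The intrinsic denominator `q_int(y)`: the least denominator over all representations
`y = π(w_1 ⋯ w_l (w_{l+1} ⋯ w_n)^∞)`. -/
noncomputable def intrinsicDenominator (y : EuclideanSpace ℝ (Fin d)) : ℕ :=
  sInf {m | ∃ (n : ℕ) (w : Fin n → A) (l : Fin n),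
    Φ.coding (eventuallyPeriodic w l) = y ∧ Φ.denominator w l = m}

/-- `n(y)`: the least `n` such that `y = π(w_1 ⋯ w_l (w_{l+1} ⋯ w_n)^∞)` for some word `w` of
length `n` and some `0 ≤ l ≤ n - 1`. -/
noncomputable def intrinsicLength (y : EuclideanSpace ℝ (Fin d)) : ℕ :=
  sInf {n | ∃ (w : Fin n → A) (l : Fin n), Φ.coding (eventuallyPeriodic w l) = y}

/-- The set of `x ∈ X` such that `‖x - y‖ < g(n(y)) / q_int(y)` for infinitely many
rational points `y` of `X`. -/
def approximableSet (g : ℕ → ℝ≥0) : Set (EuclideanSpace ℝ (Fin d)) :=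
  {x | x ∈ Φ.selfSimilarSet ∧
    {y | y ∈ Φ.rationalPoints ∧
      ‖x - y‖ < (g (Φ.intrinsicLength y) : ℝ) / (Φ.intrinsicDenominator y : ℝ)}.Infinite}

/-- The sum `∑_{n ≥ 1} ∑_{w ∈ A^n} n (Diam(φ_w(X)) g(n))^s` in `[0, ∞]` (the term `n = 0` is zero
because of the factor `n`). -/
noncomputable def volumeSum [Fintype A] (g : ℕ → ℝ≥0) (s : ℝ) : ℝ≥0∞ :=
  ∑' n : ℕ, ∑ w : Fin n → A,
    ENNReal.ofReal (n * (Metric.diam (Φ.wordMap w '' Φ.selfSimilarSet) * g n) ^ s)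

end RationalIFS

/-!
Both parts are proved by coding: by strong separation the projection `π : A^ℕ → X` is injective, and
a word `w` of length `n` with a cut `l < n` gives the rational point `y = π(w_1 ⋯ w_l (w_{l+1} ⋯
w_n)^∞)`, whose denominator is comparable to `∏ |q_{w_j}|`, the inverse of the ratio `r_w`
(`RationalIFS.denominator_bounds`).

*Convergence.* The word of any representation of `y` extends a word of length `n(y)`, so
`g(n(y)) / q_int(y)` is at most `2 g(n) r_w` for a pair `(w, l)` representing `y` with `n = n(y)`
(`RationalIFS.exists_periodicPoint_eq`). The approximable set is thus contained in the upper limit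
of the balls `B(y, 2 g(n) r_w)`, with `n` choices of `l` for each `w`, and the series of the theorem
is the one in the Borel-Cantelli lemma for Hausdorff measures
(`hausdorffMeasure_setOf_infinite_eq_zero`).

*Divergence.* If the letters of `a` from position `n` on repeat those from some position `l < n` on,
along a word of weight at most a constant times `g(n) ^ dim_S`, then the rational point that repeats
`a_l ⋯ a_{n-1}` is close enough to `π(a)` (`RationalIFS.norm_sub_lt_of_return`). It remains to find
such returns for infinitely many `n`, almost surely. As the words of length `n` have total weight
`1`, the hypothesis says that `∑ n g(n) ^ dim_S` diverges, that is, `∑ 4 ^ k ε_k = ∞` for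
`ε_k = min (c * g(2 ^ (k + 3)) ^ dim_S) (4 ^ (-k))`. Returns are looked for inside the disjoint
blocks `[4 * 2 ^ k, 8 * 2 ^ k)`, which makes these events independent, and with `l` and `n` in two
separate halves of the block. Words are cut where their weight drops to `ε_k` (stopping words), so
that a given pair `(l, n)` is a return with probability of order `ε_k`, and about `4 ^ k ε_k ≤ 1`
returns are expected. The second moment of their number is of the same order
(`BernoulliShift.exists_le_measureReal_recurrenceSet`): overlapping words are dependent, but two
prescribed stopping words at distance `j` have joint probability at most `ε * max ε (ρ ^ j)`, where
`ρ < 1` bounds the weights of the letters. So a return occurs with probability at least a constant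
times `4 ^ k ε_k`, and the second Borel-Cantelli lemma applies
(`BernoulliShift.ae_frequently_mem_recurrenceSet`). The points so obtained are infinitely many since
almost every `π(a)` is none of the points `π(w_1 ⋯ w_l (w_{l+1} ⋯ w_n)^∞)`.

The entropy inequality is used to see that there are at least two letters, so that `dim_S > 0` and
`ρ < 1`.
-/

namespace BernoulliShift

/-! ### A second moment inequality and a geometric sum -/

section Counting

/-- A second moment inequality: if `Z` counts the events `E i` that occur, then
`2 λ 𝔼[Z] - 𝔼[Z ^ 2] ≤ λ ^ 2 ℙ(Z ≠ 0)`, because `2 λ Z - Z ^ 2 ≤ λ ^ 2` pointwise. -/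
lemma two_mul_sum_measureReal_le {Ω ι : Type*} [MeasurableSpace Ω] (m : Measure Ω)
    [IsProbabilityMeasure m] (I : Finset ι) (E : ι → Set Ω) (hE : ∀ i, MeasurableSet (E i))
    (t : ℝ) :
    2 * t * ∑ i ∈ I, m.real (E i) ≤
      t ^ 2 * m.real (⋃ i ∈ I, E i) + ∑ i ∈ I, ∑ j ∈ I, m.real (E i ∩ E j) := by
  have hU : MeasurableSet (⋃ i ∈ I, E i) := I.measurableSet_biUnion fun i _ => hE i
  have hint : ∀ s : Set Ω, MeasurableSet s → Integrable (s.indicator (1 : Ω → ℝ)) m :=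
    fun s hs => (integrable_const (1 : ℝ)).indicator hs
  have hL : ∫ x, 2 * t * ∑ i ∈ I, (E i).indicator (1 : Ω → ℝ) x ∂m
      = 2 * t * ∑ i ∈ I, m.real (E i) := by
    rw [integral_const_mul, integral_finsetSum _ fun i _ => hint _ (hE i)]
    simp [integral_indicator_one, hE]
  have hR : ∫ x, (t ^ 2 * (⋃ i ∈ I, E i).indicator (1 : Ω → ℝ) x
        + ∑ i ∈ I, ∑ j ∈ I, (E i ∩ E j).indicator (1 : Ω → ℝ) x) ∂m
      = t ^ 2 * m.real (⋃ i ∈ I, E i) + ∑ i ∈ I, ∑ j ∈ I, m.real (E i ∩ E j) := by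
    rw [integral_add ((hint _ hU).const_mul _) (integrable_finsetSum _ fun i _ =>
      integrable_finsetSum _ fun j _ => hint _ ((hE i).inter (hE j))), integral_const_mul,
      integral_indicator_one hU, integral_finsetSum _ fun i _ =>
      integrable_finsetSum _ fun j _ => hint _ ((hE i).inter (hE j))]
    congr 1
    refine Finset.sum_congr rfl fun i _ => ?_
    rw [integral_finsetSum _ fun j _ => hint _ ((hE i).inter (hE j))]
    exact Finset.sum_congr rfl fun j _ => integral_indicator_one ((hE i).inter (hE j))
  rw [← hL, ← hR]
  refine integral_mono ((integrable_finsetSum _ fun i _ => hint _ (hE i)).const_mul _)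
    (((hint _ hU).const_mul _).add (integrable_finsetSum _ fun i _ =>
      integrable_finsetSum _ fun j _ => hint _ ((hE i).inter (hE j)))) fun x => ?_
  have hsq : ∑ i ∈ I, ∑ j ∈ I, (E i ∩ E j).indicator (1 : Ω → ℝ) x
      = (∑ i ∈ I, (E i).indicator (1 : Ω → ℝ) x) ^ 2 := by
    rw [sq, Finset.sum_mul_sum]
    simp [Set.inter_indicator_one]
  simp only [hsq]
  by_cases hx : x ∈ ⋃ i ∈ I, E i
  · rw [Set.indicator_of_mem hx]
    simp only [Pi.one_apply]
    nlinarith [sq_nonneg (t - ∑ i ∈ I, (E i).indicator (1 : Ω → ℝ) x)]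
  · have h0 : ∑ i ∈ I, (E i).indicator (1 : Ω → ℝ) x = 0 := by
      refine Finset.sum_eq_zero fun i hi => Set.indicator_of_notMem (fun h => hx ?_) _
      exact Set.mem_biUnion hi h
    rw [h0, Set.indicator_of_notMem hx]
    simp

lemma sum_pow_dist_le {θ : ℝ} (h0 : 0 ≤ θ) (h1 : θ < 1) (K l : ℕ) :
    ∑ l' ∈ Finset.range K, θ ^ Nat.dist l l' ≤ 2 / (1 - θ) := by
  have hgeom : ∀ n, ∑ i ∈ Finset.range n, θ ^ i ≤ (1 - θ)⁻¹ := fun n =>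
    (Summable.sum_le_tsum _ (fun i _ => pow_nonneg h0 i)
      (summable_geometric_of_lt_one h0 h1)).trans (tsum_geometric_of_lt_one h0 h1).le
  have hsub : Finset.range K ⊆ Finset.range ((l + 1) + K) :=
    Finset.range_mono (by omega)
  calc ∑ l' ∈ Finset.range K, θ ^ Nat.dist l l'
      ≤ ∑ l' ∈ Finset.range ((l + 1) + K), θ ^ Nat.dist l l' :=
        Finset.sum_le_sum_of_subset_of_nonneg hsub fun _ _ _ => pow_nonneg h0 _
    _ = ∑ i ∈ Finset.range (l + 1), θ ^ Nat.dist l i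
        + ∑ i ∈ Finset.range K, θ ^ Nat.dist l (l + 1 + i) := Finset.sum_range_add _ _ _
    _ ≤ ∑ i ∈ Finset.range (l + 1), θ ^ i + ∑ i ∈ Finset.range K, θ ^ i := by
        refine add_le_add (le_of_eq ?_) (Finset.sum_le_sum fun i _ => ?_)
        · rw [← Finset.sum_range_reflect (fun i => θ ^ i)]
          refine Finset.sum_congr rfl fun i hi => ?_
          have := Finset.mem_range.1 hi
          congr 1
          unfold Nat.dist
          omega
        · refine pow_le_pow_of_le_one h0 h1.le ?_
          unfold Nat.dist
          omega
    _ ≤ (1 - θ)⁻¹ + (1 - θ)⁻¹ := add_le_add (hgeom _) (hgeom _)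
    _ = 2 / (1 - θ) := by ring

end Counting

/-! ### Independence of events that depend on disjoint sets of letters -/

section DependsOn

variable {A : Type*} [Finite A] [MeasurableSpace A] [DiscreteMeasurableSpace A]
  (ν : Measure A) [IsProbabilityMeasure ν]

lemma exists_eq_restrict_preimage {A : Type*} {S : Finset ℕ} {E : Set (ℕ → A)}
    (hE : DependsOn (· ∈ E) (S : Set ℕ)) :
    ∃ B : Set (S → A), E = (fun x (i : S) => x i) ⁻¹' B := by
  refine ⟨(fun x (i : S) => x i) '' E, Set.Subset.antisymm (Set.subset_preimage_image _ _) ?_⟩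
  rintro x ⟨y, hy, hxy⟩
  exact (hE (x := y) (y := x) fun i hi => congrFun hxy ⟨i, hi⟩).mp hy

lemma measurableSet_of_dependsOn {S : Finset ℕ} {E : Set (ℕ → A)}
    (hE : DependsOn (· ∈ E) (S : Set ℕ)) : MeasurableSet E := by
  obtain ⟨B, rfl⟩ := exists_eq_restrict_preimage hE
  exact (measurable_pi_lambda _ fun i => measurable_pi_apply _) (Set.toFinite B).measurableSet

/-- The Bernoulli measure on sequences of independent letters with law `ν`. -/
noncomputable abbrev bernoulliMeasure {A : Type*} [MeasurableSpace A] (ν : Measure A)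
    [IsProbabilityMeasure ν] : Measure (ℕ → A) :=
  Measure.infinitePi fun _ : ℕ => ν

lemma measure_inter_of_dependsOn {S T : Finset ℕ} (hST : Disjoint S T) {E F : Set (ℕ → A)}
    (hE : DependsOn (· ∈ E) (S : Set ℕ)) (hF : DependsOn (· ∈ F) (T : Set ℕ)) :
    bernoulliMeasure ν (E ∩ F) = bernoulliMeasure ν E * bernoulliMeasure ν F := by
  obtain ⟨B, rfl⟩ := exists_eq_restrict_preimage hE
  obtain ⟨C, rfl⟩ := exists_eq_restrict_preimage hF
  have h1 : ProbabilityTheory.iIndepFun (fun (i : ℕ) (x : ℕ → A) => x i) (bernoulliMeasure ν) :=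
    ProbabilityTheory.iIndepFun_infinitePi (P := fun _ => ν) (X := fun _ a => a)
      fun _ => measurable_id
  exact (h1.indepFun_finset S T hST fun i => measurable_pi_apply i).measure_inter_preimage_eq_mul
    _ _ (Set.toFinite B).measurableSet (Set.toFinite C).measurableSet

lemma iIndepSet_of_dependsOn {S : ℕ → Finset ℕ} (hS : Pairwise (Function.onFun Disjoint S))
    {E : ℕ → Set (ℕ → A)} (hE : ∀ k, DependsOn (· ∈ E k) (S k : Set ℕ)) :
    ProbabilityTheory.iIndepSet E (bernoulliMeasure ν) := by
  classical
  rw [ProbabilityTheory.iIndepSet_iff_meas_biInter fun k => measurableSet_of_dependsOn (hE k)]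
  intro s
  induction s using Finset.induction_on with
  | empty => simp
  | insert k s hk ih =>
    rw [Finset.set_biInter_insert, Finset.prod_insert hk, ← ih]
    refine measure_inter_of_dependsOn ν (S := S k) (T := s.biUnion S) ?_ (hE k) ?_
    · rw [Finset.disjoint_biUnion_right]
      exact fun j hj => hS fun h => hk (h ▸ hj)
    · intro x y hxy
      simp only [Set.mem_iInter, eq_iff_iff]
      refine forall₂_congr fun j hj => ?_
      refine iff_of_eq (hE j (x := x) (y := y) fun i hi => hxy i ?_)
      simp only [Finset.coe_biUnion, Set.mem_iUnion]
      exact ⟨j, hj, hi⟩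

lemma measureReal_cylinder {A : Type*} [MeasurableSpace A] [DiscreteMeasurableSpace A]
    (ν : Measure A) [IsProbabilityMeasure ν] (S : Finset ℕ) (y : ℕ → A) :
    (bernoulliMeasure ν).real {x | ∀ i ∈ S, x i = y i} = ∏ i ∈ S, ν.real {y i} := by
  have h := Measure.infinitePi_pi (fun _ : ℕ => ν) (s := S) (t := fun i => {y i})
    fun _ _ => MeasurableSet.of_discrete
  have hset : {x : ℕ → A | ∀ i ∈ S, x i = y i} = Set.pi (S : Set ℕ) fun i => {y i} := by
    ext x
    simp [Set.mem_pi]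
  rw [hset, Measure.real, h, ENNReal.toReal_prod]
  rfl

/-- Two independent discrete variables `f`, `g` coincide with probability
`∑ t, ℙ(f = t) ℙ(g = t)`. -/
lemma measureReal_eq_sum_mul {β : Type*} {S S' : Finset ℕ} (hS : Disjoint S S')
    {f g : (ℕ → A) → β} (hf : DependsOn f (S : Set ℕ)) (hg : DependsOn g (S' : Set ℕ))
    (T : Finset β) (hT : ∀ x, f x ∈ T) :
    (bernoulliMeasure ν).real {x | f x = g x}
      = ∑ t ∈ T, (bernoulliMeasure ν).real {x | f x = t} *
          (bernoulliMeasure ν).real {x | g x = t} := by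
  have hf' : ∀ t, DependsOn (· ∈ {x | f x = t}) (S : Set ℕ) := fun t x y h => by
    simp [hf h]
  have hg' : ∀ t, DependsOn (· ∈ {x | g x = t}) (S' : Set ℕ) := fun t x y h => by
    simp [hg h]
  have hset : {x | f x = g x} = ⋃ t ∈ T, {x | f x = t} ∩ {x | g x = t} := by
    ext x
    simp only [Set.mem_ofPred_eq, Set.mem_iUnion, Set.mem_inter_iff, exists_prop]
    exact ⟨fun h => ⟨f x, hT x, rfl, h.symm⟩, fun ⟨t, _, h1, h2⟩ => h1.trans h2.symm⟩
  rw [hset, measureReal_biUnion_finset]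
  · refine Finset.sum_congr rfl fun t _ => ?_
    rw [Measure.real, measure_inter_of_dependsOn ν hS (hf' t) (hg' t), ENNReal.toReal_mul]
    rfl
  · intro t _ t' _ htt'
    refine Set.disjoint_left.2 fun x hx hx' => htt' (hx.1.symm.trans hx'.1)
  · exact fun t _ => (measurableSet_of_dependsOn (hf' t)).inter (measurableSet_of_dependsOn (hg' t))

lemma sum_measureReal_eq_one {β : Type*} {S : Finset ℕ} {f : (ℕ → A) → β}
    (hf : DependsOn f (S : Set ℕ)) (T : Finset β) (hT : ∀ x, f x ∈ T) :
    ∑ t ∈ T, (bernoulliMeasure ν).real {x | f x = t} = 1 := by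
  have hf' : ∀ t, DependsOn (· ∈ {x | f x = t}) (S : Set ℕ) := fun t x y h => by
    simp [hf h]
  rw [← measureReal_biUnion_finset]
  · have : ⋃ t ∈ T, {x | f x = t} = Set.univ := by
      ext x
      simpa using hT x
    rw [this]
    simp
  · intro t _ t' _ htt'
    exact Set.disjoint_left.2 fun x hx hx' => htt' (hx.symm.trans hx')
  · exact fun t _ => measurableSet_of_dependsOn (hf' t)

/-- The Cauchy-Schwarz bound for the sum in `measureReal_eq_sum_mul`: a discrete law with all
probabilities at most `a` satisfies `∑ t, ℙ(f = t) ^ 2 ≤ a`. -/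
lemma sum_measureReal_mul_le {β : Type*} {S S' : Finset ℕ}
    {f g : (ℕ → A) → β} (hf : DependsOn f (S : Set ℕ)) (hg : DependsOn g (S' : Set ℕ))
    (T : Finset β) (hTf : ∀ x, f x ∈ T) (hTg : ∀ x, g x ∈ T) {a b : ℝ}
    (ha : ∀ t, (bernoulliMeasure ν).real {x | f x = t} ≤ a)
    (hb : ∀ t, (bernoulliMeasure ν).real {x | g x = t} ≤ b) :
    ∑ t ∈ T, (bernoulliMeasure ν).real {x | f x = t} * (bernoulliMeasure ν).real {x | g x = t}
      ≤ √a * √b := by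
  have key : ∀ {h : (ℕ → A) → β} {c : ℝ} {R : Finset ℕ}, DependsOn h (R : Set ℕ) →
      (∀ x, h x ∈ T) → (∀ t, (bernoulliMeasure ν).real {x | h x = t} ≤ c) →
      ∑ t ∈ T, (bernoulliMeasure ν).real {x | h x = t} ^ 2 ≤ c := by
    intro h c R hR hT hc
    calc ∑ t ∈ T, (bernoulliMeasure ν).real {x | h x = t} ^ 2
        ≤ ∑ t ∈ T, c * (bernoulliMeasure ν).real {x | h x = t} := by
          refine Finset.sum_le_sum fun t _ => ?_
          rw [sq]
          exact mul_le_mul_of_nonneg_right (hc t) measureReal_nonneg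
      _ = c := by rw [← Finset.mul_sum, sum_measureReal_eq_one ν hR T hT, mul_one]
  refine (Real.sum_mul_le_sqrt_mul_sqrt _ _ _).trans ?_
  exact mul_le_mul (Real.sqrt_le_sqrt (key hf hTf ha)) (Real.sqrt_le_sqrt (key hg hTg hb))
    (Real.sqrt_nonneg _) (Real.sqrt_nonneg _)

end DependsOn

/-! ### Stopping words -/

section StoppingWord

variable {A : Type*} (p : A → ℝ) (ε : ℝ)

/-- The length of the shortest prefix of `x` whose weight, the product of the weights `p` of its
letters, is at most `ε`. It is `0` if there is no such prefix. -/
noncomputable def stoppingTime (x : ℕ → A) : ℕ :=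
  sInf {n | ∏ i ∈ Finset.range n, p (x i) ≤ ε}

/-- The shortest prefix of weight at most `ε` of the sequence `x` read from position `c` on. -/
noncomputable def stoppingWord (c : ℕ) (x : ℕ → A) : List A :=
  (List.range (stoppingTime p ε fun i => x (c + i))).map fun i => x (c + i)

variable {p ε} {κ ρ : ℝ} {M : ℕ}

lemma prod_le_pow (hp0 : ∀ a, 0 ≤ p a) (hp : ∀ a, p a ≤ ρ) (x : ℕ → A) (n : ℕ) :
    ∏ i ∈ Finset.range n, p (x i) ≤ ρ ^ n := by
  have := Finset.prod_le_prod (s := Finset.range n) (fun i _ => hp0 (x i)) fun i _ => hp (x i)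
  simpa using this

lemma stoppingTime_spec (hp0 : ∀ a, 0 ≤ p a) (hp : ∀ a, p a ≤ ρ) (hM : ρ ^ M ≤ ε) (x : ℕ → A) :
    ∏ i ∈ Finset.range (stoppingTime p ε x), p (x i) ≤ ε :=
  Nat.sInf_mem (s := {n | ∏ i ∈ Finset.range n, p (x i) ≤ ε})
    ⟨M, (prod_le_pow hp0 hp x M).trans hM⟩

lemma stoppingTime_le (hp0 : ∀ a, 0 ≤ p a) (hp : ∀ a, p a ≤ ρ) (hM : ρ ^ M ≤ ε) (x : ℕ → A) :
    stoppingTime p ε x ≤ M :=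
  Nat.sInf_le ((prod_le_pow hp0 hp x M).trans hM)

lemma mul_le_prod_stoppingTime (hκ : ∀ a, κ ≤ p a) (hκ0 : 0 ≤ κ) (hκ1 : κ ≤ 1) (hε0 : 0 ≤ ε)
    (hε1 : ε ≤ 1) (x : ℕ → A) :
    ε * κ ≤ ∏ i ∈ Finset.range (stoppingTime p ε x), p (x i) := by
  rcases h : stoppingTime p ε x with _ | n
  · simpa using mul_le_one₀ hε1 hκ0 hκ1
  · rw [Finset.prod_range_succ]
    have hn : ¬ ∏ i ∈ Finset.range n, p (x i) ≤ ε :=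
      fun hn => absurd (Nat.sInf_le (s := {n | ∏ i ∈ Finset.range n, p (x i) ≤ ε}) hn)
        (by unfold stoppingTime at h; omega)
    exact mul_le_mul (not_le.1 hn).le (hκ _) hκ0 (hε0.trans (not_le.1 hn).le)

lemma stoppingTime_congr (hp0 : ∀ a, 0 ≤ p a) (hp : ∀ a, p a ≤ ρ) (hM : ρ ^ M ≤ ε) {x y : ℕ → A}
    (h : ∀ i < stoppingTime p ε y, x i = y i) : stoppingTime p ε x = stoppingTime p ε y := by
  have hprod : ∀ n ≤ stoppingTime p ε y,
      ∏ i ∈ Finset.range n, p (x i) = ∏ i ∈ Finset.range n, p (y i) := fun n hn =>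
    Finset.prod_congr rfl fun i hi => by rw [h i ((Finset.mem_range.1 hi).trans_le hn)]
  have hle : stoppingTime p ε x ≤ stoppingTime p ε y := by
    refine Nat.sInf_le ?_
    rw [Set.mem_ofPred_eq, hprod _ le_rfl]
    exact stoppingTime_spec hp0 hp hM y
  refine le_antisymm hle (Nat.sInf_le ?_)
  rw [Set.mem_ofPred_eq, ← hprod _ hle]
  exact stoppingTime_spec hp0 hp hM x

lemma stoppingWord_eq_iff (hp0 : ∀ a, 0 ≤ p a) (hp : ∀ a, p a ≤ ρ) (hM : ρ ^ M ≤ ε)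
    {x y : ℕ → A} {c c' : ℕ} : stoppingWord p ε c x = stoppingWord p ε c' y ↔
      ∀ i < stoppingTime p ε (fun i => y (c' + i)), x (c + i) = y (c' + i) := by
  constructor
  · intro h i hi
    have hlen := congrArg List.length h
    simp only [stoppingWord, List.length_map, List.length_range] at hlen
    unfold stoppingWord at h
    rw [hlen, List.map_inj_left] at h
    exact h i (List.mem_range.2 hi)
  · intro h
    unfold stoppingWord
    rw [stoppingTime_congr hp0 hp hM h]
    exact List.map_congr_left fun i hi => h i (List.mem_range.1 hi)

lemma length_stoppingWord_le (hp0 : ∀ a, 0 ≤ p a) (hp : ∀ a, p a ≤ ρ) (hM : ρ ^ M ≤ ε)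
    (c : ℕ) (x : ℕ → A) : (stoppingWord p ε c x).length ≤ M := by
  simpa [stoppingWord] using stoppingTime_le hp0 hp hM fun i => x (c + i)

lemma dependsOn_stoppingWord (hp0 : ∀ a, 0 ≤ p a) (hp : ∀ a, p a ≤ ρ) (hM : ρ ^ M ≤ ε) {c : ℕ}
    {S : Finset ℕ} (hS : Finset.Ico c (c + M) ⊆ S) :
    DependsOn (stoppingWord p ε c) (S : Set ℕ) := fun x y h =>
  (stoppingWord_eq_iff hp0 hp hM).2 fun i hi => h _ <| hS <| Finset.mem_Ico.2
    ⟨by omega, by have := stoppingTime_le hp0 hp hM fun i => y (c + i); omega⟩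

end StoppingWord

/-! ### Coincidences of stopping words in a block -/

section Recurrence

variable {A : Type*} [MeasurableSpace A] {ν : Measure A} {ε ρ : ℝ} {K : ℕ}

variable (ν) in
/-- The stopping word for the weights `ν {a}`. -/
noncomputable abbrev stopWord (ε : ℝ) : ℕ → (ℕ → A) → List A :=
  stoppingWord (fun a => ν.real {a}) ε

/-- A stopping word occurs at a given position with probability equal to its weight. -/
lemma measureReal_stopWord_eq [DiscreteMeasurableSpace A] [IsProbabilityMeasure ν]
    (hρ : ∀ a, ν.real {a} ≤ ρ) (hM : ρ ^ K ≤ ε) (c : ℕ) (y : ℕ → A)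
    (c' : ℕ) :
    (bernoulliMeasure ν).real {x | stopWord ν ε c x = stopWord ν ε c' y} =
      ∏ i ∈ Finset.range (stoppingTime (fun a => ν.real {a}) ε fun i => y (c' + i)),
        ν.real {y (c' + i)} := by
  set τ := stoppingTime (fun a => ν.real {a}) ε fun i => y (c' + i)
  have hset : {x | stopWord ν ε c x = stopWord ν ε c' y}
      = {x | ∀ i ∈ Finset.Ico c (c + τ), x i = (fun j => y (c' + (j - c))) i} := by
    ext x
    simp only [Set.mem_ofPred_eq, Finset.mem_Ico]
    rw [stopWord, stoppingWord_eq_iff (fun a => measureReal_nonneg) hρ hM]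
    constructor
    · rintro h i ⟨h1, h2⟩
      have := h (i - c) (by omega)
      rwa [Nat.add_sub_cancel' h1] at this
    · intro h i hi
      have := h (c + i) ⟨by omega, by omega⟩
      rwa [Nat.add_sub_cancel_left] at this
  rw [hset, measureReal_cylinder, Finset.prod_Ico_eq_prod_range]
  simp

/-- Two stopping words read from positions at distance `j` take given values with probability at
most `ε * max ε (ρ ^ j)`: the event fixes the second word and either all of the first word or the
`j` letters in front of the second one. -/
lemma measureReal_pair_le_of_le [DiscreteMeasurableSpace A] [IsProbabilityMeasure ν]
    (hρ : ∀ a, ν.real {a} ≤ ρ) (hM : ρ ^ K ≤ ε) (c j : ℕ)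
    (z z' : List A) :
    (bernoulliMeasure ν).real {x | stopWord ν ε c x = z ∧ stopWord ν ε (c + j) x = z'} ≤
      ε * max ε (ρ ^ j) := by
  have h0 : ∀ a, 0 ≤ ν.real {a} := fun a => measureReal_nonneg
  obtain hemp | ⟨y, rfl, rfl⟩ :=
    Set.eq_empty_or_nonempty {x | stopWord ν ε c x = z ∧ stopWord ν ε (c + j) x = z'}
  · have hA : Nonempty A := by
      have : (Set.univ : Set A).Nonempty := by
        refine nonempty_of_measure_ne_zero (μ := ν) ?_
        simp
      exact this.to_type
    obtain ⟨a⟩ := hA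
    have hρ0 : 0 ≤ ρ := (h0 a).trans (hρ a)
    have hε : 0 ≤ ε := (pow_nonneg hρ0 K).trans hM
    rw [hemp, measureReal_empty]
    exact mul_nonneg hε (le_max_of_le_left hε)
  set τ := stoppingTime (fun a => ν.real {a}) ε fun i => y (c + i)
  set τ' := stoppingTime (fun a => ν.real {a}) ε fun i => y (c + j + i)
  have hsub : {x | stopWord ν ε c x = stopWord ν ε c y ∧
      stopWord ν ε (c + j) x = stopWord ν ε (c + j) y} ⊆
      {x | ∀ i ∈ Finset.Ico c (c + min j τ) ∪ Finset.Ico (c + j) (c + j + τ'), x i = y i} := by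
    rintro x ⟨h1, h2⟩ i hi
    rw [stopWord, stoppingWord_eq_iff h0 hρ hM] at h1 h2
    simp only [Finset.mem_union, Finset.mem_Ico] at hi
    rcases hi with hi | hi
    · have := h1 (i - c) (by omega)
      rwa [Nat.add_sub_cancel' hi.1] at this
    · have := h2 (i - (c + j)) (by omega)
      rwa [Nat.add_sub_cancel' hi.1] at this
  refine (measureReal_mono hsub).trans ?_
  rw [measureReal_cylinder, Finset.prod_union (Finset.disjoint_left.2 fun i h1 h2 => by
    rw [Finset.mem_Ico] at h1 h2; omega), Finset.prod_Ico_eq_prod_range,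
    Finset.prod_Ico_eq_prod_range, Nat.add_sub_cancel_left, Nat.add_sub_cancel_left, mul_comm]
  have hε : 0 ≤ ε := (Finset.prod_nonneg fun i _ => h0 _).trans
    (stoppingTime_spec h0 hρ hM fun i => y (c + i))
  refine mul_le_mul (stoppingTime_spec h0 hρ hM fun i => y (c + j + i)) ?_
    (Finset.prod_nonneg fun i _ => h0 _) hε
  rcases le_total j τ with h | h
  · rw [min_eq_left h]
    exact le_max_of_le_right (prod_le_pow h0 hρ (fun i => y (c + i)) j)
  · rw [min_eq_right h]
    exact le_max_of_le_left (stoppingTime_spec h0 hρ hM fun i => y (c + i))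

lemma measureReal_pair_le [DiscreteMeasurableSpace A] [IsProbabilityMeasure ν]
    (hρ : ∀ a, ν.real {a} ≤ ρ) (hM : ρ ^ K ≤ ε) (c c' : ℕ)
    (z : List A × List A) :
    (bernoulliMeasure ν).real {x | (stopWord ν ε c x, stopWord ν ε c' x) = z} ≤
      ε * max ε (ρ ^ Nat.dist c c') := by
  obtain ⟨z, z'⟩ := z
  simp only [Prod.mk.injEq]
  rcases le_total c c' with h | h
  · obtain ⟨j, rfl⟩ := Nat.exists_eq_add_of_le h
    rw [Nat.dist_eq_sub_of_le h, Nat.add_sub_cancel_left]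
    exact measureReal_pair_le_of_le hρ hM c j z z'
  · obtain ⟨j, rfl⟩ := Nat.exists_eq_add_of_le h
    rw [Nat.dist_comm, Nat.dist_eq_sub_of_le h, Nat.add_sub_cancel_left]
    simp only [and_comm (a := stopWord ν ε (c' + j) _ = z)]
    exact measureReal_pair_le_of_le hρ hM c' j z' z

/-- The sequence contains, at positions `s ≤ i < s + K` and `s + 2 * K ≤ j < s + 3 * K`, two equal
stopping words. -/
def recurrenceSet (ν : Measure A) (ε : ℝ) (s K : ℕ) : Set (ℕ → A) :=
  {x | ∃ l < K, ∃ n < K, stopWord ν ε (s + l) x = stopWord ν ε (s + 2 * K + n) x}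

lemma dependsOn_recurrenceSet (hρ : ∀ a, ν.real {a} ≤ ρ) (hM : ρ ^ K ≤ ε) (s : ℕ) :
    DependsOn (· ∈ recurrenceSet ν ε s K) (Finset.Ico s (s + 4 * K) : Set ℕ) := by
  intro x y hxy
  have h : ∀ c, s ≤ c → c + K ≤ s + 4 * K → stopWord ν ε c x = stopWord ν ε c y := fun c h1 h2 =>
    dependsOn_stoppingWord (fun a => measureReal_nonneg) hρ hM
      (Finset.Ico_subset_Ico h1 h2) hxy
  simp only [recurrenceSet, Set.mem_ofPred_eq, eq_iff_iff]
  refine exists_congr fun l => and_congr_right fun hl => exists_congr fun n =>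
    and_congr_right fun hn => ?_
  rw [h _ (by omega) (by omega), h _ (by omega) (by omega)]

/-- The sum of the square roots of the overlap bounds over all pairs of positions is of order
`K * √ε`: pairs at distance `j` contribute a geometric series in `√ρ ^ j`. -/
lemma sum_sqrt_le {ε ρ : ℝ} (hε : 0 ≤ ε) (hρ0 : 0 ≤ ρ) (hρ1 : ρ < 1) {K : ℕ}
    (hK : (K : ℝ) ^ 2 * ε ≤ 1) :
    ∑ l ∈ Finset.range K, ∑ l' ∈ Finset.range K, √(ε * max ε (ρ ^ Nat.dist l l')) ≤
      K * √ε * (1 + 2 / (1 - √ρ)) := by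
  have hterm : ∀ n : ℕ, √(ε * max ε (ρ ^ n)) ≤ ε + √ε * √ρ ^ n := by
    intro n
    have h1 : √ε * √ε = ε := Real.mul_self_sqrt hε
    have h2 : √(ρ ^ n) = √ρ ^ n := by
      rw [Real.sqrt_eq_iff_mul_self_eq (by positivity) (by positivity), ← mul_pow,
        Real.mul_self_sqrt hρ0]
    rw [Real.sqrt_mul hε]
    have h3 : √(max ε (ρ ^ n)) ≤ √ε + √ρ ^ n := by
      rcases max_cases ε (ρ ^ n) with ⟨h, _⟩ | ⟨h, _⟩ <;> rw [h]
      · linarith [pow_nonneg (Real.sqrt_nonneg ρ) n]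
      · rw [h2]
        linarith [Real.sqrt_nonneg ε]
    nlinarith [Real.sqrt_nonneg ε]
  have hθ : √ρ < 1 := by
    rw [Real.sqrt_lt' one_pos]
    simpa using hρ1
  have hKε : K * √ε ≤ 1 := by
    rw [← Real.sqrt_sq (Nat.cast_nonneg K), ← Real.sqrt_mul (by positivity)]
    exact Real.sqrt_le_one.2 hK
  calc ∑ l ∈ Finset.range K, ∑ l' ∈ Finset.range K, √(ε * max ε (ρ ^ Nat.dist l l'))
      ≤ ∑ l ∈ Finset.range K, (K * ε + √ε * (2 / (1 - √ρ))) := by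
        refine Finset.sum_le_sum fun l _ => (Finset.sum_le_sum fun l' _ => hterm _).trans ?_
        rw [Finset.sum_add_distrib, ← Finset.mul_sum]
        refine add_le_add (by simp) (mul_le_mul_of_nonneg_left
          (sum_pow_dist_le (Real.sqrt_nonneg _) hθ K l) (Real.sqrt_nonneg _))
    _ = K * (K * √ε) * √ε + K * √ε * (2 / (1 - √ρ)) := by
        simp only [Finset.sum_const, Finset.card_range, nsmul_eq_mul]
        rw [mul_add, mul_assoc (K : ℝ) (K * √ε), mul_assoc (K : ℝ) √ε √ε, Real.mul_self_sqrt hε]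
        ring
    _ ≤ K * 1 * √ε + K * √ε * (2 / (1 - √ρ)) := by gcongr
    _ = K * √ε * (1 + 2 / (1 - √ρ)) := by ring

lemma finite_range_stopWord [Finite A] (hρ : ∀ a, ν.real {a} ≤ ρ) (hM : ρ ^ K ≤ ε) :
    ∃ T : Finset (List A), ∀ c x, stopWord ν ε c x ∈ T :=
  ⟨(List.finite_length_le A K).toFinset, fun c x => by
    simpa using length_stoppingWord_le (fun a => measureReal_nonneg) hρ hM c x⟩

/-- Equal stopping words occur in a block of length `4 K` with probability at least a constant
times `K ^ 2 * ε`, by the second moment method. With `Z` the number of coincidences, `𝔼[Z]` is at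
least of order `K ^ 2 * ε`. Expanding `𝔼[Z ^ 2]` over pairs of coincidences, the Cauchy-Schwarz
inequality separates the two halves of the block, and the overlap bound `measureReal_pair_le` gives
`𝔼[Z ^ 2] ≤ C * K ^ 2 * ε` although overlapping words are dependent. -/
lemma exists_le_measureReal_recurrenceSet [Finite A] [DiscreteMeasurableSpace A]
    (ν : Measure A) [IsProbabilityMeasure ν] {κ ρ : ℝ} (hκ0 : 0 < κ) (hρ1 : ρ < 1)
    (hκ : ∀ a, κ ≤ ν.real {a}) (hρ : ∀ a, ν.real {a} ≤ ρ) :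
    ∃ c : ℝ, 0 < c ∧ ∀ (s K : ℕ) (ε : ℝ), 0 ≤ ε → ε ≤ 1 → (K : ℝ) ^ 2 * ε ≤ 1 → ρ ^ K ≤ ε →
      c * (K ^ 2 * ε) ≤ (bernoulliMeasure ν).real (recurrenceSet ν ε s K) := by
  obtain ⟨a₀⟩ : Nonempty A := by
    have : (Set.univ : Set A).Nonempty := nonempty_of_measure_ne_zero (μ := ν) (by simp)
    exact this.to_type
  have hρ0 : 0 ≤ ρ := hκ0.le.trans ((hκ a₀).trans (hρ a₀))
  have hκ1 : κ ≤ 1 := ((hκ a₀).trans (hρ a₀)).trans hρ1.le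
  have h0 : ∀ a, 0 ≤ ν.real {a} := fun a => measureReal_nonneg
  have hθ : √ρ < 1 := by
    rw [Real.sqrt_lt' one_pos]
    simpa using hρ1
  set C : ℝ := (1 + 2 / (1 - √ρ)) ^ 2
  have hC0 : 0 < C := by
    have : 0 < 1 - √ρ := by linarith
    positivity
  refine ⟨κ ^ 2 / C, by positivity, fun s K ε hε0 hε1 hK hM => ?_⟩
  set m := bernoulliMeasure ν
  set W := stopWord ν ε
  obtain ⟨T, hT⟩ := finite_range_stopWord (ν := ν) hρ hM
  set S := Finset.Ico s (s + 2 * K)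
  set S' := Finset.Ico (s + 2 * K) (s + 4 * K)
  have hSS' : Disjoint S S' := Finset.disjoint_left.2 fun i h1 h2 => by
    simp only [S, S', Finset.mem_Ico] at h1 h2
    omega
  have hdep : ∀ l < K, DependsOn (W (s + l)) (S : Set ℕ) := fun l hl =>
    dependsOn_stoppingWord h0 hρ hM (Finset.Ico_subset_Ico (by omega) (by omega))
  have hdep' : ∀ n < K, DependsOn (W (s + 2 * K + n)) (S' : Set ℕ) := fun n hn =>
    dependsOn_stoppingWord h0 hρ hM (Finset.Ico_subset_Ico (by omega) (by omega))
  set E : ℕ × ℕ → Set (ℕ → A) := fun i => {x | W (s + i.1) x = W (s + 2 * K + i.2) x}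
  set I := Finset.range K ×ˢ Finset.range K
  have hE : ∀ i, MeasurableSet (E i) := by
    intro i
    refine measurableSet_of_dependsOn
      (S := Finset.Ico (s + i.1) (s + i.1 + K) ∪ Finset.Ico (s + 2 * K + i.2) (s + 2 * K + i.2 + K))
      fun x y h => ?_
    have h1 := dependsOn_stoppingWord h0 hρ hM (c := s + i.1) Finset.subset_union_left h
    have h2 := dependsOn_stoppingWord h0 hρ hM (c := s + 2 * K + i.2) Finset.subset_union_right h
    simp only [E, W, Set.mem_ofPred_eq, h1, h2]
  have hU : recurrenceSet ν ε s K = ⋃ i ∈ I, E i := by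
    ext x
    simp only [recurrenceSet, I, E, W, Set.mem_ofPred_eq, Set.mem_iUnion, Finset.mem_product,
      Finset.mem_range, Prod.exists, exists_prop]
    exact ⟨fun ⟨l, hl, n, hn, h⟩ => ⟨l, n, ⟨hl, hn⟩, h⟩,
      fun ⟨l, n, ⟨hl, hn⟩, h⟩ => ⟨l, hl, n, hn, h⟩⟩
  have hfirst : K ^ 2 * ε * κ ≤ ∑ i ∈ I, m.real (E i) := by
    have : ∀ i ∈ I, ε * κ ≤ m.real (E i) := by
      intro i hi
      simp only [I, Finset.mem_product, Finset.mem_range] at hi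
      rw [measureReal_eq_sum_mul ν hSS' (hdep _ hi.1) (hdep' _ hi.2) T (hT _)]
      calc ε * κ = ∑ t ∈ T, m.real {x | W (s + i.1) x = t} * (ε * κ) := by
            rw [← Finset.sum_mul, sum_measureReal_eq_one ν (hdep _ hi.1) T (hT _), one_mul]
        _ ≤ _ := by
          refine Finset.sum_le_sum fun t _ => ?_
          obtain hemp | ⟨y, rfl⟩ := Set.eq_empty_or_nonempty {x | W (s + i.1) x = t}
          · simp [hemp]
          · refine mul_le_mul_of_nonneg_left ?_ measureReal_nonneg
            rw [measureReal_stopWord_eq hρ hM]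
            exact mul_le_prod_stoppingTime hκ hκ0.le hκ1 hε0 hε1 _
    calc K ^ 2 * ε * κ = ∑ i ∈ I, ε * κ := by
          simp only [I, Finset.sum_const, Finset.card_product, Finset.card_range, nsmul_eq_mul]
          push_cast
          ring
      _ ≤ _ := Finset.sum_le_sum this
  have hsecond : ∑ i ∈ I, ∑ j ∈ I, m.real (E i ∩ E j) ≤ K ^ 2 * ε * C := by
    have hpair : ∀ i ∈ I, ∀ j ∈ I, m.real (E i ∩ E j) ≤
        √(ε * max ε (ρ ^ Nat.dist i.1 j.1)) * √(ε * max ε (ρ ^ Nat.dist i.2 j.2)) := by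
      intro i hi j hj
      simp only [I, Finset.mem_product, Finset.mem_range] at hi hj
      have hset : E i ∩ E j = {x | (W (s + i.1) x, W (s + j.1) x)
          = (W (s + 2 * K + i.2) x, W (s + 2 * K + j.2) x)} := by
        ext x
        simp [E]
      have d1 : DependsOn (fun x => (W (s + i.1) x, W (s + j.1) x)) (S : Set ℕ) :=
        fun x y h => Prod.ext (hdep _ hi.1 h) (hdep _ hj.1 h)
      have d2 : DependsOn (fun x => (W (s + 2 * K + i.2) x, W (s + 2 * K + j.2) x))
          (S' : Set ℕ) := fun x y h => Prod.ext (hdep' _ hi.2 h) (hdep' _ hj.2 h)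
      rw [hset, measureReal_eq_sum_mul ν hSS' d1 d2 (T ×ˢ T)
        fun x => Finset.mk_mem_product (hT _ _) (hT _ _)]
      refine sum_measureReal_mul_le ν d1 d2 (T ×ˢ T)
        (fun x => Finset.mk_mem_product (hT _ _) (hT _ _))
        (fun x => Finset.mk_mem_product (hT _ _) (hT _ _)) (fun z => ?_) fun z => ?_
      · rw [← Nat.dist_add_add_left s]
        exact measureReal_pair_le hρ hM _ _ z
      · rw [← Nat.dist_add_add_left (s + 2 * K)]
        exact measureReal_pair_le hρ hM _ _ z
    refine (Finset.sum_le_sum fun i hi => Finset.sum_le_sum fun j hj => hpair i hi j hj).trans ?_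
    have hfac : ∑ i ∈ I, ∑ j ∈ I,
        √(ε * max ε (ρ ^ Nat.dist i.1 j.1)) * √(ε * max ε (ρ ^ Nat.dist i.2 j.2))
        = (∑ l ∈ Finset.range K, ∑ l' ∈ Finset.range K, √(ε * max ε (ρ ^ Nat.dist l l'))) ^ 2 := by
      simp only [I, Finset.sum_product, sq, Finset.sum_mul_sum]
    rw [hfac]
    calc _ ≤ (K * √ε * (1 + 2 / (1 - √ρ))) ^ 2 :=
          pow_le_pow_left₀ (Finset.sum_nonneg fun _ _ => Finset.sum_nonneg fun _ _ =>
            Real.sqrt_nonneg _) (sum_sqrt_le hε0 hρ0 hρ1 hK) 2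
      _ = K ^ 2 * ε * C := by
          rw [mul_pow, mul_pow, Real.sq_sqrt hε0]
  -- The parameter `C / κ` optimizes the second moment inequality.
  have h2 := two_mul_sum_measureReal_le m I E hE (C / κ)
  rw [hU]
  have h3 : 2 * (C / κ) * (K ^ 2 * ε * κ) ≤
      (C / κ) ^ 2 * m.real (⋃ i ∈ I, E i) + K ^ 2 * ε * C :=
    (mul_le_mul_of_nonneg_left hfirst (by positivity)).trans (h2.trans (by gcongr))
  have h4 : K ^ 2 * ε * C ≤ (C / κ) ^ 2 * m.real (⋃ i ∈ I, E i) := by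
    have : 2 * (C / κ) * (K ^ 2 * ε * κ) = 2 * (K ^ 2 * ε * C) := by
      field_simp
    linarith
  calc κ ^ 2 / C * (K ^ 2 * ε) = (κ / C) ^ 2 * (K ^ 2 * ε * C) := by
        field_simp
    _ ≤ (κ / C) ^ 2 * ((C / κ) ^ 2 * m.real (⋃ i ∈ I, E i)) := by gcongr
    _ = m.real (⋃ i ∈ I, E i) := by
        field_simp

end Recurrence

/-! ### Returns in infinitely many blocks, and condensation of series -/

section BorelCantelli

lemma tsum_four_pow_mul_pow_ne_top {ρ : ℝ} (hρ0 : 0 ≤ ρ) (hρ1 : ρ < 1) :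
    ∑' k : ℕ, ENNReal.ofReal (4 ^ k * ρ ^ 2 ^ k) ≠ ∞ := by
  have h1 : Summable fun n : ℕ => (n : ℝ) ^ 2 * ρ ^ n :=
    summable_pow_mul_geometric_of_norm_lt_one 2 (by rwa [Real.norm_of_nonneg hρ0])
  have h2 := h1.comp_injective (Nat.pow_right_injective le_rfl)
  refine (Summable.congr h2 fun k => ?_).tsum_ofReal_ne_top
  simp only [Function.comp_apply]
  push_cast
  rw [← pow_mul, mul_comm k 2, pow_mul]
  norm_num

/-- Equal stopping words occur in infinitely many of the disjoint blocks `[4 * 2 ^ k, 8 * 2 ^ k)`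
almost surely, by the second Borel-Cantelli lemma. -/
lemma ae_frequently_mem_recurrenceSet {A : Type*} [Finite A] [MeasurableSpace A]
    [DiscreteMeasurableSpace A] (ν : Measure A) [IsProbabilityMeasure ν] {κ ρ : ℝ}
    (hκ0 : 0 < κ) (hρ1 : ρ < 1) (hκ : ∀ a, κ ≤ ν.real {a}) (hρ : ∀ a, ν.real {a} ≤ ρ)
    {ε : ℕ → ℝ} (hε0 : ∀ k, 0 ≤ ε k) (hε1 : ∀ k, 4 ^ k * ε k ≤ 1)
    (hsum : ∑' k, ENNReal.ofReal (4 ^ k * ε k) = ∞) :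
    ∀ᵐ x ∂bernoulliMeasure ν, ∃ᶠ k in atTop,
      ρ ^ 2 ^ k ≤ ε k ∧ x ∈ recurrenceSet ν (ε k) (4 * 2 ^ k) (2 ^ k) := by
  obtain ⟨a₀⟩ : Nonempty A := by
    have : (Set.univ : Set A).Nonempty := nonempty_of_measure_ne_zero (μ := ν) (by simp)
    exact this.to_type
  have hρ0 : 0 ≤ ρ := hκ0.le.trans ((hκ a₀).trans (hρ a₀))
  obtain ⟨c, hc, hF⟩ := exists_le_measureReal_recurrenceSet ν hκ0 hρ1 hκ hρ
  -- Scales too small for the stopping words to fit into their block are dropped; they contribute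
  -- a convergent series.
  set F : ℕ → Set (ℕ → A) := fun k =>
    {x | ρ ^ 2 ^ k ≤ ε k ∧ x ∈ recurrenceSet ν (ε k) (4 * 2 ^ k) (2 ^ k)}
  set S : ℕ → Finset ℕ := fun k => Finset.Ico (4 * 2 ^ k) (4 * 2 ^ k + 4 * 2 ^ k)
  have hdep : ∀ k, DependsOn (· ∈ F k) (S k : Set ℕ) := by
    intro k x y hxy
    simp only [F, Set.mem_ofPred_eq, eq_iff_iff]
    exact and_congr_right fun hk => iff_of_eq (dependsOn_recurrenceSet hρ hk _ hxy)
  have hS : Pairwise (Function.onFun Disjoint S) := by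
    have key : ∀ i j, i < j → Disjoint (S i) (S j) := by
      intro i j hij
      refine Finset.disjoint_left.2 fun n h1 h2 => ?_
      simp only [S, Finset.mem_Ico] at h1 h2
      have : 2 ^ (i + 1) ≤ 2 ^ j := Nat.pow_le_pow_right two_pos hij
      rw [pow_succ] at this
      omega
    intro i j hij
    rcases hij.lt_or_gt with h | h
    · exact key i j h
    · exact (key j i h).symm
  have hle : ∀ k, ENNReal.ofReal (4 ^ k * ε k) ≤
      ENNReal.ofReal c⁻¹ * bernoulliMeasure ν (F k) + ENNReal.ofReal (4 ^ k * ρ ^ 2 ^ k) := by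
    intro k
    by_cases hk : ρ ^ 2 ^ k ≤ ε k
    · refine le_add_right ?_
      have hFk : F k = recurrenceSet ν (ε k) (4 * 2 ^ k) (2 ^ k) := by
        ext x
        simp [F, hk]
      have h4 : ((2 ^ k : ℕ) : ℝ) ^ 2 = 4 ^ k := by
        push_cast
        rw [← pow_mul, mul_comm k 2, pow_mul]
        norm_num
      have hε1' : ε k ≤ 1 := by
        refine le_trans ?_ (hε1 k)
        exact le_mul_of_one_le_left (hε0 k) (one_le_pow₀ (by norm_num))
      have := hF (4 * 2 ^ k) (2 ^ k) (ε k) (hε0 k) hε1' (by rw [h4]; exact hε1 k) hk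
      rw [h4, ← hFk] at this
      rw [← ofReal_measureReal, ← ENNReal.ofReal_mul (by positivity)]
      refine ENNReal.ofReal_le_ofReal ?_
      rwa [← div_eq_inv_mul, le_div_iff₀' hc]
    · refine le_add_left (ENNReal.ofReal_le_ofReal ?_)
      have := (not_le.1 hk).le
      gcongr
  have hdiv : ∑' k, bernoulliMeasure ν (F k) = ∞ := by
    by_contra h
    have h2 := ENNReal.tsum_le_tsum hle
    rw [hsum, top_le_iff, ENNReal.tsum_add, ENNReal.tsum_mul_left, ENNReal.add_eq_top] at h2
    rcases h2 with h2 | h2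
    · exact ENNReal.mul_ne_top ENNReal.ofReal_ne_top h h2
    · exact tsum_four_pow_mul_pow_ne_top hρ0 hρ1 h2
  have hm : ∀ k, MeasurableSet (F k) := fun k => measurableSet_of_dependsOn (hdep k)
  have h1 := ProbabilityTheory.measure_limsup_eq_one hm (iIndepSet_of_dependsOn ν hS hdep) hdiv
  have h2 : ∀ᵐ x ∂bernoulliMeasure ν, x ∈ limsup F atTop :=
    (mem_ae_iff_prob_eq_one (.measurableSet_limsup hm)).2 h1
  filter_upwards [h2] with x hx
  exact mem_limsup_iff_frequently_mem.1 hx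

lemma measure_singleton_eq_zero {A : Type*} [MeasurableSpace A]
    [DiscreteMeasurableSpace A] (ν : Measure A) [IsProbabilityMeasure ν] {ρ : ℝ}
    (hρ1 : ρ < 1) (hρ : ∀ a, ν.real {a} ≤ ρ) (y : ℕ → A) : bernoulliMeasure ν {y} = 0 := by
  have hρ0 : 0 ≤ ρ := measureReal_nonneg.trans (hρ (y 0))
  have hle : ∀ n : ℕ, (bernoulliMeasure ν).real {y} ≤ ρ ^ n := fun n => by
    refine (measureReal_mono (s₂ := {x | ∀ i ∈ Finset.range n, x i = y i}) ?_).trans ?_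
    · rintro x rfl
      simp
    · rw [measureReal_cylinder]
      exact prod_le_pow (fun a => measureReal_nonneg) hρ y n
  have h0 := ge_of_tendsto' (tendsto_pow_atTop_nhds_zero_of_lt_one hρ0 hρ1) hle
  exact (measureReal_eq_zero_iff).1 (le_antisymm h0 measureReal_nonneg)

/-- Cauchy condensation for `∑ n G(n)`. -/
lemma tsum_four_pow_mul_eq_top {G : ℕ → ℝ≥0∞} (hG : AntitoneOn G (Set.Ici 1))
    (hsum : ∑' n : ℕ, n * G n = ∞) : ∑' k : ℕ, 4 ^ k * G (2 ^ k) = ∞ := by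
  have hpart : ∀ K : ℕ, ∑ n ∈ Finset.range (2 ^ K), n * G n ≤
      2 * ∑ k ∈ Finset.range K, 4 ^ k * G (2 ^ k) := by
    intro K
    induction K with
    | zero => simp
    | succ K ih =>
      rw [Finset.sum_range_succ, mul_add, pow_succ, mul_two, Finset.sum_range_add]
      refine add_le_add ih ?_
      calc ∑ i ∈ Finset.range (2 ^ K), ((2 ^ K + i : ℕ) : ℝ≥0∞) * G (2 ^ K + i)
          ≤ ∑ i ∈ Finset.range (2 ^ K), ((2 ^ K + 2 ^ K : ℕ) : ℝ≥0∞) * G (2 ^ K) := by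
            refine Finset.sum_le_sum fun i hi => ?_
            have h1 : 1 ≤ 2 ^ K := Nat.one_le_two_pow
            gcongr
            · exact (Finset.mem_range.1 hi).le
            · exact hG h1 (h1.trans (Nat.le_add_right _ i)) (Nat.le_add_right _ i)
        _ = 2 * (4 ^ K * G (2 ^ K)) := by
            rw [Finset.sum_const, Finset.card_range, nsmul_eq_mul]
            push_cast
            rw [show (4 : ℝ≥0∞) = 2 * 2 by norm_num, mul_pow]
            ring
  by_contra h
  have hle : ∑' n : ℕ, n * G n ≤ 2 * ∑' k : ℕ, 4 ^ k * G (2 ^ k) := by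
    rw [ENNReal.tsum_eq_iSup_nat]
    refine iSup_le fun n => ?_
    refine (Finset.sum_le_sum_of_subset
      (Finset.range_mono (Nat.lt_two_pow_self (n := n)).le)).trans ?_
    exact (hpart n).trans (mul_le_mul_right (ENNReal.sum_le_tsum _) _)
  rw [hsum, top_le_iff] at hle
  exact ENNReal.mul_ne_top (by norm_num) h hle

lemma tsum_min_one_eq_top {a : ℕ → ℝ≥0∞} (ha : ∀ k, a k ≠ ∞) (hsum : ∑' k, a k = ∞) :
    ∑' k, min (a k) 1 = ∞ := by
  by_contra h
  have hev : ∀ᶠ k in atTop, min (a k) 1 < 1 :=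
    (ENNReal.tendsto_atTop_zero_of_tsum_ne_top h).eventually (gt_mem_nhds one_pos)
  obtain ⟨N, hN⟩ := eventually_atTop.1 hev
  have htail : ∀ k, a (k + N) = min (a (k + N)) 1 := fun k => by
    have := hN (k + N) (Nat.le_add_left _ _)
    rw [min_lt_iff] at this
    exact (min_eq_left (this.resolve_right (lt_irrefl _)).le).symm
  rw [← ENNReal.summable.sum_add_tsum_nat_add' (f := a) (k := N), ENNReal.add_eq_top] at hsum
  rcases hsum with hsum | hsum
  · exact ENNReal.sum_ne_top.2 (fun k _ => ha k) hsum
  · refine h (top_le_iff.1 (hsum.ge.trans ?_))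
    rw [tsum_congr htail]
    exact ENNReal.tsum_comp_le_tsum_of_injective (add_left_injective N) fun k => min (a k) 1

end BorelCantelli

end BernoulliShift

/-! ### The Borel-Cantelli lemma for Hausdorff measures -/

/-- The convergence part of the Borel-Cantelli lemma for Hausdorff measures. -/
lemma hausdorffMeasure_setOf_infinite_eq_zero {X ι : Type*} [EMetricSpace X] [MeasurableSpace X]
    [BorelSpace X] [Countable ι] {s : ℝ} (hs : 0 < s) (B : ι → Set X)
    (hB : ∑' i, Metric.ediam (B i) ^ s ≠ ∞) : μH[s] {x | {i | x ∈ B i}.Infinite} = 0 := by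
  have h0 := ENNReal.tendsto_tsum_compl_atTop_zero hB
  have hr : Tendsto (fun F : Finset ι => (∑' i : {i // i ∉ F}, Metric.ediam (B i) ^ s) ^ s⁻¹)
      atTop (𝓝 0) := by
    have := (ENNReal.continuous_rpow_const (y := s⁻¹)).tendsto 0 |>.comp h0
    rwa [ENNReal.zero_rpow_of_pos (inv_pos.2 hs)] at this
  have h1 := Measure.hausdorffMeasure_le_liminf_tsum (ι := fun F : Finset ι => {i // i ∉ F}) s
    {x | {i | x ∈ B i}.Infinite} _ hr (fun F i => B i)
    (Eventually.of_forall fun F i => by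
      rw [← ENNReal.rpow_rpow_inv hs.ne' (Metric.ediam (B i))]
      exact ENNReal.rpow_le_rpow (ENNReal.le_tsum i) (inv_nonneg.2 hs.le))
    (Eventually.of_forall fun F x hx => by
      obtain ⟨i, hi, hiF⟩ := Set.Infinite.exists_notMem_finset hx F
      exact Set.mem_iUnion.2 ⟨⟨i, hiF⟩, hi⟩)
  rw [h0.liminf_eq] at h1
  exact le_antisymm h1 bot_le

namespace RationalIFS

variable {A : Type*} {d : ℕ} (Φ : RationalIFS A d)

/-! ### The coding map -/

section Coding

lemma dist_wordMap {n : ℕ} (w : Fin n → A) (x y : EuclideanSpace ℝ (Fin d)) :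
    dist (Φ.wordMap w x) (Φ.wordMap w y) = (∏ i, Φ.ratio (w i)) * dist x y := by
  induction n with
  | zero => simp [wordMap]
  | succ n ih =>
    have h := ih (fun i => w i.succ)
    simp only [wordMap, List.ofFn_succ, List.foldr_cons, dist_map] at h ⊢
    rw [h, Fin.prod_univ_succ, mul_assoc]

lemma diam_wordMap_image [Finite A] {n : ℕ} (w : Fin n → A) :
    Metric.diam (Φ.wordMap w '' Φ.selfSimilarSet)
      = (∏ i, Φ.ratio (w i)) * Metric.diam Φ.selfSimilarSet := by
  have hr : 0 < ∏ i, Φ.ratio (w i) := Finset.prod_pos fun i _ => Φ.ratio_pos _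
  have hX := Φ.isCompact_selfSimilarSet.isBounded
  have hcont : Continuous (Φ.wordMap w) := by
    refine (LipschitzWith.of_dist_le_mul (K := ⟨_, hr.le⟩) fun x y => ?_).continuous
    exact (Φ.dist_wordMap w x y).le
  have hX' := (Φ.isCompact_selfSimilarSet.image hcont).isBounded
  refine le_antisymm ?_ ?_
  · refine Metric.diam_le_of_forall_dist_le (mul_nonneg hr.le Metric.diam_nonneg) ?_
    rintro _ ⟨x, hx, rfl⟩ _ ⟨y, hy, rfl⟩
    rw [dist_wordMap]
    exact mul_le_mul_of_nonneg_left (Metric.dist_le_diam_of_mem hX hx hy) hr.le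
  · rw [← le_div_iff₀' hr]
    refine Metric.diam_le_of_forall_dist_le (div_nonneg Metric.diam_nonneg hr.le) ?_
    intro x hx y hy
    rw [le_div_iff₀' hr, ← dist_wordMap]
    exact Metric.dist_le_diam_of_mem hX' (Set.mem_image_of_mem _ hx) (Set.mem_image_of_mem _ hy)

lemma coding_eq_wordMap [Finite A] (a : ℕ → A) (n : ℕ) :
    Φ.coding a = Φ.wordMap (fun i : Fin n => a i) (Φ.coding fun i => a (n + i)) := by
  induction n generalizing a with
  | zero => simp [wordMap]
  | succ n ih =>
    rw [coding_eq, ih fun i => a (i + 1), wordMap_prefix_succ]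
    simp only [Nat.add_right_comm]

lemma coding_injective [Finite A] (hΦ : Φ.StrongSeparation) : Function.Injective Φ.coding := by
  have hhead : ∀ a b : ℕ → A, Φ.coding a = Φ.coding b →
      a 0 = b 0 ∧ Φ.coding (fun n => a (n + 1)) = Φ.coding fun n => b (n + 1) := by
    intro a b h
    have h0 : a 0 = b 0 := by
      by_contra hne
      refine Set.disjoint_left.1 (hΦ hne) ⟨_, ⟨fun n => a (n + 1), rfl⟩, (Φ.coding_eq a).symm⟩ ?_
      rw [h, Φ.coding_eq b]
      exact ⟨_, ⟨_, rfl⟩, rfl⟩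
    refine ⟨h0, ?_⟩
    rw [Φ.coding_eq a, Φ.coding_eq b, h0, ← dist_eq_zero, dist_map, mul_eq_zero] at h
    exact dist_eq_zero.1 (h.resolve_left (Φ.ratio_pos _).ne')
  intro a b h
  have : ∀ (n : ℕ) (a b : ℕ → A), Φ.coding a = Φ.coding b → a n = b n := by
    intro n
    induction n with
    | zero => exact fun a b h => (hhead a b h).1
    | succ n ih => exact fun a b h => ih _ _ (hhead a b h).2
  exact funext fun n => this n a b h

lemma dist_coding_le [Finite A] {a b : ℕ → A} {n : ℕ} (h : ∀ i < n, a i = b i) :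
    dist (Φ.coding a) (Φ.coding b) ≤
      (∏ i ∈ Finset.range n, Φ.ratio (a i)) * Metric.diam Φ.selfSimilarSet := by
  have hab : (fun i : Fin n => b i) = fun i : Fin n => a i := funext fun i => (h i i.2).symm
  rw [Φ.coding_eq_wordMap a n, Φ.coding_eq_wordMap b n, hab, dist_wordMap,
    Fin.prod_univ_eq_prod_range fun i => Φ.ratio (a i)]
  exact mul_le_mul_of_nonneg_left (Metric.dist_le_diam_of_mem
    Φ.isCompact_selfSimilarSet.isBounded ⟨_, rfl⟩ ⟨_, rfl⟩)
    (Finset.prod_nonneg fun i _ => (Φ.ratio_pos _).le)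

end Coding

/-! ### Eventually periodic sequences and their denominators -/

section EventuallyPeriodic

lemma eventuallyPeriodic_of_lt {n : ℕ} (w : Fin n → A) (l : Fin n) {i : ℕ} (hi : i < n) :
    eventuallyPeriodic w l i = w ⟨i, hi⟩ := by
  unfold eventuallyPeriodic
  split_ifs with h
  · rfl
  · congr 2
    rw [Nat.mod_eq_of_lt (by omega)]
    omega

lemma eventuallyPeriodic_add {n : ℕ} (w : Fin n → A) (l : Fin n) (i : ℕ) :
    eventuallyPeriodic w l (n + i) = eventuallyPeriodic w l (l + i) := by
  have hl := l.2
  unfold eventuallyPeriodic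
  rw [dif_neg (by omega), dif_neg (by omega)]
  congr 2
  rw [show n + i - l = (l + i - l) + (n - l) by omega, Nat.add_mod_right]

/-- If the letters of `a` from position `n` on repeat those from position `l < n` on for `t` steps,
then `a` agrees with `a_0 ⋯ a_{l-1} (a_l ⋯ a_{n-1})^∞` in its first `n + t` letters. -/
lemma eventuallyPeriodic_prefix {a : ℕ → A} {n t : ℕ} (l : Fin n)
    (h : ∀ i < t, a (l + i) = a (n + i)) :
    ∀ i < n + t, eventuallyPeriodic (fun j : Fin n => a j) l i = a i := by
  intro i
  induction i using Nat.strong_induction_on with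
  | _ i ih =>
    intro hi
    rcases lt_or_ge i n with hin | hin
    · rw [eventuallyPeriodic_of_lt _ _ hin]
    · obtain ⟨j, rfl⟩ := Nat.exists_eq_add_of_le hin
      have := l.2
      rw [eventuallyPeriodic_add, ih _ (by omega) (by omega), h j (by omega)]

lemma prod_ratio_eventuallyPeriodic {n : ℕ} (w : Fin n → A) (l : Fin n) :
    ∏ i ∈ Finset.range n, Φ.ratio (eventuallyPeriodic w l i) = ∏ i, Φ.ratio (w i) := by
  rw [← Fin.prod_univ_eq_prod_range fun i => Φ.ratio (eventuallyPeriodic w l i)]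
  exact Finset.prod_congr rfl fun i _ => by rw [eventuallyPeriodic_of_lt w l i.2]

lemma denominator_bounds {n : ℕ} (w : Fin n → A) (l : Fin n) :
    (∏ i, Φ.ratio (w i))⁻¹ ≤ 2 * (Φ.denominator w l : ℝ) ∧
      (Φ.denominator w l : ℝ) ≤ 2 * (∏ i, Φ.ratio (w i))⁻¹ := by
  have hq : ∀ a, (2 : ℝ) ≤ |(Φ.q a : ℝ)| := fun a => by exact_mod_cast Φ.two_le_abs_q a
  set P : ℝ := ∏ j with j < l, (Φ.q (w j) : ℝ)
  set Q : ℝ := ∏ j with l ≤ j, (Φ.q (w j) : ℝ)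
  have hden : (Φ.denominator w l : ℝ) = |P| * |Q - 1| := by
    rw [denominator, Nat.cast_natAbs, ← abs_mul]
    push_cast
    rfl
  have hPQ : (∏ i, Φ.ratio (w i))⁻¹ = |P| * |Q| := by
    simp only [ratio, Finset.prod_inv_distrib, inv_inv, ← Finset.abs_prod, ← abs_mul]
    rw [← Finset.prod_filter_mul_prod_filter_not Finset.univ fun j => j < l]
    simp only [not_lt, P, Q]
  have hQ : 2 ≤ |Q| := by
    rw [Finset.abs_prod]
    calc (2 : ℝ) = ∏ j with l ≤ j, if j = l then (2 : ℝ) else 1 := by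
          simp [Finset.prod_ite_eq']
      _ ≤ _ := Finset.prod_le_prod (fun j _ => by split_ifs <;> norm_num) fun j _ => by
          have := hq (w j)
          split_ifs <;> linarith
  have h1 : |Q| - 1 ≤ |Q - 1| := by simpa using abs_sub_abs_le_abs_sub Q 1
  have h2 : |Q - 1| ≤ |Q| + 1 := by simpa using abs_sub Q 1
  have hP := abs_nonneg P
  rw [hden, hPQ]
  constructor <;> nlinarith

lemma denominator_pos {n : ℕ} (w : Fin n → A) (l : Fin n) : 0 < Φ.denominator w l := by
  have h : 0 < (∏ i, Φ.ratio (w i))⁻¹ := inv_pos.2 (Finset.prod_pos fun i _ => Φ.ratio_pos _)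
  have := h.trans_le (Φ.denominator_bounds w l).1
  exact_mod_cast pos_of_mul_pos_right this zero_le_two

lemma exists_wordMap_eq {n : ℕ} (w : Fin n → A) : ∃ (r : ℚ) (c : Fin d → ℚ), |r| ≤ (1 / 2) ^ n ∧
    ∀ x i, Φ.wordMap w x i = r * x i + c i := by
  induction n with
  | zero => exact ⟨1, 0, by simp, by simp [wordMap]⟩
  | succ n ih =>
    obtain ⟨r, c, hr, h⟩ := ih fun i => w i.succ
    refine ⟨(Φ.q (w 0) : ℚ)⁻¹ * r, fun i => (Φ.q (w 0) : ℚ)⁻¹ * (c i + Φ.p (w 0) i), ?_, ?_⟩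
    · have hq : (2 : ℚ) ≤ |(Φ.q (w 0) : ℚ)| := by exact_mod_cast Φ.two_le_abs_q (w 0)
      rw [abs_mul, pow_succ', abs_inv, one_div]
      exact mul_le_mul (inv_anti₀ two_pos hq) (by simpa using hr) (abs_nonneg _) (by norm_num)
    · intro x i
      have h' : Φ.wordMap w x = Φ.map (w 0) (Φ.wordMap (fun i => w i.succ) x) := by
        simp [wordMap, List.ofFn_succ]
      rw [h', map]
      simp only [PiLp.smul_apply, PiLp.add_apply, h, smul_eq_mul]
      push_cast
      ring

lemma coding_eventuallyPeriodic_mem [Finite A] {n : ℕ} (w : Fin n → A) (l : Fin n) :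
    Φ.coding (eventuallyPeriodic w l) ∈ Φ.rationalPoints := by
  refine ⟨⟨_, rfl⟩, fun i => ?_⟩
  set a := eventuallyPeriodic w l
  have hl := l.2
  set y := Φ.coding fun i => a (l + i)
  -- The purely periodic tail is the fixed point of a rational contraction.
  have hy : y = Φ.wordMap (fun i : Fin (n - l) => a (l + i)) y := by
    have h := Φ.coding_eq_wordMap (fun i => a (l + i)) (n - l)
    have h' : (fun i => a (l + ((n - l) + i))) = fun i => a (l + i) := by
      funext i
      exact (congrArg a (by omega)).trans (eventuallyPeriodic_add w l i)
    rwa [h'] at h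
  obtain ⟨r, c, hr, h⟩ := Φ.exists_wordMap_eq fun i : Fin (n - l) => a (l + i)
  obtain ⟨r', c', -, h'⟩ := Φ.exists_wordMap_eq fun i : Fin l => a i
  have hr1 : (r : ℝ) ≠ 1 := by
    rintro hr1
    have : r = 1 := by exact_mod_cast hr1
    rw [this, abs_one] at hr
    exact absurd hr (not_le.2 (pow_lt_one₀ (by norm_num) (by norm_num) (by omega)))
  have hyi : y i = c i / (1 - r) := by
    have : y i = r * y i + c i := by
      conv_lhs => rw [hy, h]
    rw [eq_div_iff (sub_ne_zero.2 hr1.symm)]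
    linarith
  refine ⟨r' * (c i / (1 - r)) + c' i, ?_⟩
  rw [Φ.coding_eq_wordMap a l, h']
  change r' * y i + c' i = _
  rw [hyi]
  push_cast
  rfl

end EventuallyPeriodic

/-! ### The convergence case -/

section Convergence

/-- The point `π(w_1 ⋯ w_l (w_{l+1} ⋯ w_n)^∞)` given by a triple `(n, w, l)`. -/
noncomputable def periodicPoint (i : Σ n : ℕ, (Fin n → A) × Fin n) : EuclideanSpace ℝ (Fin d) :=
  Φ.coding (eventuallyPeriodic i.2.1 i.2.2)

/-- A rational point with positive approximation radius has a representation of length `n(y)`, and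
its radius is at most `2 g(n) ∏ r_{w_j}`. The word of any other representation extends `w`, as the
coding is injective, so its denominator is not much smaller. -/
lemma exists_periodicPoint_eq [Finite A] (hΦ : Φ.StrongSeparation) (g : ℕ → ℝ≥0)
    {y : EuclideanSpace ℝ (Fin d)} {r : ℝ} (hr0 : 0 ≤ r)
    (hr : r < (g (Φ.intrinsicLength y) : ℝ) / (Φ.intrinsicDenominator y : ℝ)) :
    ∃ i : Σ n : ℕ, (Fin n → A) × Fin n, Φ.periodicPoint i = y ∧
      r < 2 * (g i.1 : ℝ) * ∏ j, Φ.ratio (i.2.1 j) := by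
  have hne : Φ.intrinsicDenominator y ≠ 0 := by
    intro h
    rw [h, Nat.cast_zero, div_zero] at hr
    linarith
  have hden := Nat.sInf_mem (Nat.nonempty_of_pos_sInf (Nat.pos_of_ne_zero hne))
  obtain ⟨n', w', l', hy', hq⟩ := hden
  obtain ⟨w, l, hy⟩ : ∃ (w : Fin (Φ.intrinsicLength y) → A) (l : Fin (Φ.intrinsicLength y)),
      Φ.coding (eventuallyPeriodic w l) = y :=
    Nat.sInf_mem (s := {n | ∃ (w : Fin n → A) (l : Fin n), Φ.coding (eventuallyPeriodic w l) = y})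
      ⟨n', w', l', hy'⟩
  have hle : Φ.intrinsicLength y ≤ n' := Nat.sInf_le ⟨w', l', hy'⟩
  have hseq := Φ.coding_injective hΦ (hy.trans hy'.symm)
  refine ⟨⟨Φ.intrinsicLength y, w, l⟩, hy, hr.trans_le ?_⟩
  have h1 := (Φ.denominator_bounds w' l').1
  rw [hq, ← Φ.prod_ratio_eventuallyPeriodic w' l', ← hseq] at h1
  have h2 : ∏ i ∈ Finset.range n', Φ.ratio (eventuallyPeriodic w l i) ≤ ∏ j, Φ.ratio (w j) := by
    rw [← Φ.prod_ratio_eventuallyPeriodic w l]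
    refine Finset.prod_le_prod_of_subset_of_le_one (Finset.range_mono hle)
      (fun i _ => (Φ.ratio_pos _).le) fun i _ _ => (Φ.ratio_le_half _).trans (by norm_num)
  have hpos : 0 < ∏ i ∈ Finset.range n', Φ.ratio (eventuallyPeriodic w l i) :=
    Finset.prod_pos fun i _ => Φ.ratio_pos _
  have h3 : (∏ j, Φ.ratio (w j))⁻¹ ≤ 2 * (Φ.intrinsicDenominator y : ℝ) :=
    (inv_anti₀ hpos h2).trans h1
  have hq0 : (0 : ℝ) < Φ.intrinsicDenominator y := by exact_mod_cast Nat.pos_of_ne_zero hne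
  have hw : 0 < ∏ j, Φ.ratio (w j) := Finset.prod_pos fun i _ => Φ.ratio_pos _
  rw [div_le_iff₀ hq0]
  rw [inv_le_iff_one_le_mul₀ hw] at h3
  have hg : (0 : ℝ) ≤ g (Φ.intrinsicLength y) := NNReal.coe_nonneg _
  calc (g (Φ.intrinsicLength y) : ℝ)
      ≤ g (Φ.intrinsicLength y) * (2 * Φ.intrinsicDenominator y * ∏ j, Φ.ratio (w j)) :=
        le_mul_of_one_le_right hg h3
    _ = _ := by ring

lemma approximableSet_subset [Finite A] (hΦ : Φ.StrongSeparation) (g : ℕ → ℝ≥0) :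
    Φ.approximableSet g ⊆ {x | {i : Σ n : ℕ, (Fin n → A) × Fin n | x ∈ Metric.ball
      (Φ.periodicPoint i) (2 * (g i.1 : ℝ) * ∏ j, Φ.ratio (i.2.1 j))}.Infinite} := by
  rintro x ⟨-, hx⟩
  refine Set.Infinite.of_image Φ.periodicPoint (hx.mono ?_)
  rintro y ⟨-, hy⟩
  obtain ⟨i, rfl, hi⟩ := Φ.exists_periodicPoint_eq hΦ g (norm_nonneg _) hy
  exact ⟨i, by rwa [Set.mem_ofPred_eq, Metric.mem_ball, dist_eq_norm], rfl⟩

lemma volumeSum_zero [Fintype A] [Nonempty A] (g : ℕ → ℝ≥0) : Φ.volumeSum g 0 = ∞ := by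
  by_contra h
  have h0 := ENNReal.tendsto_atTop_zero_of_tsum_ne_top h
  obtain ⟨n, hn, hn1⟩ := ((h0.eventually (gt_mem_nhds one_pos)).and (eventually_ge_atTop 1)).exists
  obtain ⟨a⟩ := ‹Nonempty A›
  have h1 := Finset.single_le_sum (f := fun w : Fin n → A => ENNReal.ofReal
    (n * (Metric.diam (Φ.wordMap w '' Φ.selfSimilarSet) * g n) ^ (0 : ℝ))) (fun _ _ => bot_le)
    (Finset.mem_univ fun _ => a)
  have h2 : (1 : ℝ≥0∞) ≤ n := by exact_mod_cast hn1
  simp only [Real.rpow_zero, mul_one, ENNReal.ofReal_natCast] at h1 hn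
  exact absurd hn (not_lt.2 (h2.trans h1))

lemma tsum_ediam_ball_ne_top [Fintype A] (hD : 0 < Metric.diam Φ.selfSimilarSet) (g : ℕ → ℝ≥0)
    {s : ℝ} (hs : 0 < s) (hsum : Φ.volumeSum g s < ∞) :
    ∑' i : Σ n : ℕ, (Fin n → A) × Fin n, Metric.ediam (Metric.ball (Φ.periodicPoint i)
      (2 * (g i.1 : ℝ) * ∏ j, Φ.ratio (i.2.1 j))) ^ s ≠ ∞ := by
  set D := Metric.diam Φ.selfSimilarSet
  have hle : ∀ i : Σ n : ℕ, (Fin n → A) × Fin n, Metric.ediam (Metric.ball (Φ.periodicPoint i)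
      (2 * (g i.1 : ℝ) * ∏ j, Φ.ratio (i.2.1 j))) ^ s ≤ ENNReal.ofReal ((4 / D) ^ s) *
        ENNReal.ofReal ((Metric.diam (Φ.wordMap i.2.1 '' Φ.selfSimilarSet) * g i.1) ^ s) := by
    intro i
    have hr : 0 ≤ ∏ j, Φ.ratio (i.2.1 j) := Finset.prod_nonneg fun j _ => (Φ.ratio_pos _).le
    have hd : 0 ≤ Metric.diam (Φ.wordMap i.2.1 '' Φ.selfSimilarSet) := Metric.diam_nonneg
    have h1 : Metric.ediam (Metric.ball (Φ.periodicPoint i)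
        (2 * (g i.1 : ℝ) * ∏ j, Φ.ratio (i.2.1 j))) ≤
        ENNReal.ofReal (4 / D * (Metric.diam (Φ.wordMap i.2.1 '' Φ.selfSimilarSet) * g i.1)) := by
      rw [← Metric.eball_ofReal]
      refine Metric.ediam_eball_le.trans ?_
      have h2 : ∀ r : ℝ, 2 * ENNReal.ofReal r = ENNReal.ofReal (2 * r) := fun r => by
        rw [ENNReal.ofReal_mul zero_le_two, ENNReal.ofReal_ofNat]
      rw [h2]
      refine ENNReal.ofReal_le_ofReal (le_of_eq ?_)
      rw [diam_wordMap_image]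
      field_simp
      ring
    refine (ENNReal.rpow_le_rpow h1 hs.le).trans (le_of_eq ?_)
    rw [ENNReal.ofReal_rpow_of_nonneg (by positivity) hs.le,
      Real.mul_rpow (by positivity) (by positivity), ENNReal.ofReal_mul (by positivity)]
  refine ne_top_of_le_ne_top ?_ (ENNReal.tsum_le_tsum hle)
  rw [ENNReal.tsum_mul_left]
  refine ENNReal.mul_ne_top ENNReal.ofReal_ne_top ?_
  rw [ENNReal.tsum_sigma fun n (i : (Fin n → A) × Fin n) => ENNReal.ofReal
    ((Metric.diam (Φ.wordMap i.1 '' Φ.selfSimilarSet) * g n) ^ s)]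
  refine ne_top_of_le_ne_top hsum.ne (ENNReal.tsum_le_tsum fun n => le_of_eq ?_)
  rw [tsum_fintype, Fintype.sum_prod_type]
  refine Finset.sum_congr rfl fun w _ => ?_
  simp only [Finset.sum_const, Finset.card_univ, Fintype.card_fin, nsmul_eq_mul]
  rw [ENNReal.ofReal_mul (Nat.cast_nonneg n), ENNReal.ofReal_natCast]

theorem hausdorffMeasure_approximableSet_eq_zero [Fintype A] [Nonempty A]
    (hΦ : Φ.StrongSeparation) (g : ℕ → ℝ≥0) {s : ℝ} (hs : 0 ≤ s) (hsum : Φ.volumeSum g s < ∞) :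
    μH[s] (Φ.approximableSet g) = 0 := by
  rcases hs.eq_or_lt with rfl | hs
  · exact absurd hsum (by simp [volumeSum_zero])
  rcases (Metric.diam_nonneg (s := Φ.selfSimilarSet)).eq_or_lt with hD | hD
  · -- A one-point attractor has no infinite set of rational points.
    have hsub : Φ.selfSimilarSet.Subsingleton := fun x hx y hy => by
      have := Metric.dist_le_diam_of_mem Φ.isCompact_selfSimilarSet.isBounded hx hy
      exact dist_le_zero.1 (this.trans hD.ge)
    have hemp : Φ.approximableSet g = ∅ := by
      refine Set.eq_empty_of_forall_notMem fun x hx => hx.2 ?_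
      exact hsub.finite.subset fun y hy => hy.1.1
    rw [hemp, measure_empty]
  · exact measure_mono_null (Φ.approximableSet_subset hΦ g)
      (hausdorffMeasure_setOf_infinite_eq_zero hs _ (Φ.tsum_ediam_ball_ne_top hD g hs hsum))

end Convergence

/-! ### The divergence case -/

section Divergence

lemma nontrivial_of_entropy_lt [Fintype A] [Nonempty A]
    (h : Φ.entropy < -2 * Real.log (∑ a, Φ.prob a ^ 2)) : Nontrivial A := by
  by_contra hA
  rw [not_nontrivial_iff_subsingleton] at hA
  obtain ⟨a⟩ := ‹Nonempty A›
  let : Unique A := { default := a, uniq := fun b => Subsingleton.elim b a }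
  have h1 : Φ.prob default = 1 := by simpa using Φ.sum_prob
  simp [entropy, h1] at h

lemma similarityDim_pos [Fintype A] [Nonempty A] [Nontrivial A] : 0 < Φ.similarityDim := by
  by_contra h
  have h1 : ∀ a, 1 ≤ Φ.prob a := fun a =>
    Real.one_le_rpow_of_pos_of_le_one_of_nonpos (Φ.ratio_pos a)
      ((Φ.ratio_le_half a).trans (by norm_num)) (not_lt.1 h)
  have h2 := Finset.sum_le_sum fun a (_ : a ∈ Finset.univ) => h1 a
  rw [Φ.sum_prob, Finset.sum_const, Finset.card_univ, nsmul_eq_mul, mul_one] at h2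
  have h3 : 1 < Fintype.card A := Fintype.one_lt_card
  exact absurd h2 (not_le.2 (by exact_mod_cast h3))

lemma prod_prob_eq [Fintype A] [Nonempty A] {ι : Type*} (s : Finset ι) (f : ι → A) :
    ∏ i ∈ s, Φ.prob (f i) = (∏ i ∈ s, Φ.ratio (f i)) ^ Φ.similarityDim :=
  Real.finsetProd_rpow s _ (fun _ _ => (Φ.ratio_pos _).le) _

/-- As the words of length `n` have total weight `1`, the series `volumeSum` at the similarity
dimension is `∑ n (Diam(X) g(n)) ^ dim_S`. -/
lemma volumeSum_similarityDim [Fintype A] [Nonempty A] (g : ℕ → ℝ≥0) :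
    Φ.volumeSum g Φ.similarityDim = ∑' n : ℕ, n * ENNReal.ofReal
      ((Metric.diam Φ.selfSimilarSet * g n) ^ Φ.similarityDim) := by
  refine tsum_congr fun n => ?_
  have hD := Metric.diam_nonneg (s := Φ.selfSimilarSet)
  have hterm : ∀ w : Fin n → A, ENNReal.ofReal (n * (Metric.diam
      (Φ.wordMap w '' Φ.selfSimilarSet) * g n) ^ Φ.similarityDim) =
      ENNReal.ofReal ((∏ i, Φ.prob (w i)) *
        (n * (Metric.diam Φ.selfSimilarSet * g n) ^ Φ.similarityDim)) := by
    intro w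
    have hr : 0 ≤ ∏ i, Φ.ratio (w i) := Finset.prod_nonneg fun i _ => (Φ.ratio_pos _).le
    rw [diam_wordMap_image, prod_prob_eq, mul_assoc, Real.mul_rpow hr (by positivity)]
    congr 1
    ring
  simp only [hterm]
  rw [← ENNReal.ofReal_sum_of_nonneg fun w _ => mul_nonneg
    (Finset.prod_nonneg fun i _ => (Φ.prob_pos _).le) (by positivity), ← Finset.sum_mul]
  have hone : ∑ w : Fin n → A, ∏ i, Φ.prob (w i) = 1 := by
    classical
    have := Finset.prod_univ_sum (fun _ : Fin n => (Finset.univ : Finset A)) fun _ a => Φ.prob a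
    rw [Fintype.piFinset_univ] at this
    rw [← this]
    simp [Φ.sum_prob]
  rw [hone, one_mul, ENNReal.ofReal_mul (Nat.cast_nonneg n), ENNReal.ofReal_natCast]

/-- If `a` returns from position `n` to the letters at position `l < n` for long enough, then
`π(a)` is well approximated by the rational point that repeats `a_l ⋯ a_{n-1}`. -/
lemma norm_sub_lt_of_return [Finite A] {g : ℕ → ℝ≥0} (hg : AntitoneOn g (Set.Ici 1)) {a : ℕ → A}
    {n t : ℕ} (l : Fin n) (h : ∀ i < t, a (l + i) = a (n + i)) (hgn : 0 < g n)
    (ht : ∏ i ∈ Finset.range t, Φ.ratio (a (n + i)) ≤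
      g n / (4 * (Metric.diam Φ.selfSimilarSet + 1))) :
    let y := Φ.coding (eventuallyPeriodic (fun j : Fin n => a j) l)
    ‖Φ.coding a - y‖ < (g (Φ.intrinsicLength y) : ℝ) / (Φ.intrinsicDenominator y : ℝ) := by
  intro y
  set D := Metric.diam Φ.selfSimilarSet
  have hD : 0 ≤ D := Metric.diam_nonneg
  set R := ∏ i ∈ Finset.range n, Φ.ratio (a i)
  have hR : 0 < R := Finset.prod_pos fun i _ => Φ.ratio_pos _
  have hgn' : (0 : ℝ) < g n := hgn
  have hdist : ‖Φ.coding a - y‖ ≤ R * (g n / (4 * (D + 1))) * D := by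
    rw [← dist_eq_norm]
    refine (Φ.dist_coding_le (n := n + t) fun i hi =>
      (eventuallyPeriodic_prefix l h i hi).symm).trans ?_
    rw [Finset.prod_range_add]
    gcongr
  have hlenset : n ∈ {n | ∃ (w : Fin n → A) (l : Fin n), Φ.coding (eventuallyPeriodic w l) = y} :=
    ⟨_, l, rfl⟩
  have hlen1 : 1 ≤ Φ.intrinsicLength y := by
    obtain ⟨w, l', -⟩ : ∃ (w : Fin (Φ.intrinsicLength y) → A) (l : Fin (Φ.intrinsicLength y)),
        Φ.coding (eventuallyPeriodic w l) = y := Nat.sInf_mem ⟨n, hlenset⟩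
    exact l'.pos
  have hlen : Φ.intrinsicLength y ≤ n := Nat.sInf_le hlenset
  have hgle : (g n : ℝ) ≤ g (Φ.intrinsicLength y) := by
    exact_mod_cast hg hlen1 (hlen1.trans hlen) hlen
  have hdenset : Φ.denominator (fun j : Fin n => a j) l ∈ {m | ∃ (n : ℕ) (w : Fin n → A)
      (l : Fin n), Φ.coding (eventuallyPeriodic w l) = y ∧ Φ.denominator w l = m} :=
    ⟨n, _, l, rfl, rfl⟩
  have hden0 : (0 : ℝ) < Φ.intrinsicDenominator y := by
    obtain ⟨n', w, l', -, hw⟩ : Φ.intrinsicDenominator y ∈ {m | ∃ (n : ℕ) (w : Fin n → A)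
      (l : Fin n), Φ.coding (eventuallyPeriodic w l) = y ∧ Φ.denominator w l = m} :=
      Nat.sInf_mem ⟨_, hdenset⟩
    rw [← hw]
    exact_mod_cast Φ.denominator_pos w l'
  have hden : (Φ.intrinsicDenominator y : ℝ) ≤ 2 * R⁻¹ := by
    have h1 := (Φ.denominator_bounds (fun j : Fin n => a j) l).2
    rw [Fin.prod_univ_eq_prod_range fun i => Φ.ratio (a i)] at h1
    exact le_trans (by exact_mod_cast Nat.sInf_le hdenset) h1
  rw [lt_div_iff₀ hden0]
  calc ‖Φ.coding a - y‖ * Φ.intrinsicDenominator y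
      ≤ (R * (g n / (4 * (D + 1))) * D) * (2 * R⁻¹) := by gcongr
    _ = g n * (D / (2 * (D + 1))) := by
        field_simp
        ring
    _ < g n * 1 := by
        refine mul_lt_mul_of_pos_left ?_ hgn'
        rw [div_lt_one (by positivity)]
        linarith
    _ ≤ g (Φ.intrinsicLength y) := by rwa [mul_one]

/-- A point `π(a)` that is no rational point lies in the approximable set if it admits rational
approximations as in `norm_sub_lt_of_return` for arbitrarily large `n`: these converge to `π(a)`
without meeting it, so they are infinitely many. -/
lemma coding_mem_approximableSet [Finite A] {g : ℕ → ℝ≥0} {a : ℕ → A}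
    (ha : ∀ i, Φ.periodicPoint i ≠ Φ.coding a)
    (h : ∀ N : ℕ, ∃ n, N ≤ n ∧ ∃ l : Fin n,
      let y := Φ.coding (eventuallyPeriodic (fun j : Fin n => a j) l)
      ‖Φ.coding a - y‖ < (g (Φ.intrinsicLength y) : ℝ) / (Φ.intrinsicDenominator y : ℝ)) :
    Φ.coding a ∈ Φ.approximableSet g := by
  refine ⟨⟨a, rfl⟩, fun hfin => ?_⟩
  set Y := {y | y ∈ Φ.rationalPoints ∧ ‖Φ.coding a - y‖ <
    (g (Φ.intrinsicLength y) : ℝ) / (Φ.intrinsicDenominator y : ℝ)}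
  set Z := Y ∩ Set.range Φ.periodicPoint
  have hZ : Z.Finite := hfin.subset Set.inter_subset_left
  have hmem : Zᶜ ∈ 𝓝 (Φ.coding a) := by
    refine hZ.isClosed.isOpen_compl.mem_nhds ?_
    rintro ⟨-, i, hi⟩
    exact ha i hi
  obtain ⟨η, hη, hball⟩ := Metric.mem_nhds_iff.1 hmem
  set D := Metric.diam Φ.selfSimilarSet
  have hlim : Tendsto (fun n : ℕ => ((1 : ℝ) / 2) ^ n * D) atTop (𝓝 0) := by
    simpa using (tendsto_pow_atTop_nhds_zero_of_lt_one (by norm_num : (0 : ℝ) ≤ 1 / 2)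
      (by norm_num)).mul_const D
  obtain ⟨N, hN⟩ := eventually_atTop.1 (hlim.eventually (gt_mem_nhds hη))
  obtain ⟨n, hn, l, hy⟩ := h N
  refine hball (a := Φ.coding (eventuallyPeriodic (fun j : Fin n => a j) l)) ?_
    ⟨⟨Φ.coding_eventuallyPeriodic_mem _ l, hy⟩, ⟨n, _, l⟩, rfl⟩
  rw [Metric.mem_ball, dist_comm]
  refine (Φ.dist_coding_le (n := n) fun i hi => ?_).trans_lt (lt_of_le_of_lt ?_ (hN n hn))
  · rw [eventuallyPeriodic_of_lt _ _ hi]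
  · refine mul_le_mul_of_nonneg_right ?_ Metric.diam_nonneg
    have := Finset.prod_le_prod (s := Finset.range n) (fun i _ => (Φ.ratio_pos (a i)).le)
      fun i _ => Φ.ratio_le_half (a i)
    simpa using this

/-- The coding is a measurable embedding, so that `selfSimilarMeasure` can be computed on
`approximableSet` without knowing that this set is measurable. -/
lemma measurableEmbedding_coding [Finite A] (hΦ : Φ.StrongSeparation) :
    @MeasurableEmbedding _ _ (@MeasurableSpace.pi ℕ (fun _ => A) fun _ => ⊤) _ Φ.coding := by
  let : MeasurableSpace A := ⊤
  let : TopologicalSpace A := ⊥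
  have : DiscreteTopology A := ⟨rfl⟩
  have : BorelSpace A := ⟨borel_eq_top_of_discrete.symm⟩
  exact (Φ.continuous_coding.isClosedEmbedding (Φ.coding_injective hΦ)).measurableEmbedding

/-- Divergence of `∑ 4 ^ k ε_k` for the scales `ε_k = min (c * g(2 ^ (k + 3)) ^ dim_S) (4 ^ (-k))`.
The block `[4 * 2 ^ k, 8 * 2 ^ k)` uses the value of `g` at its right end. -/
lemma tsum_four_pow_mul_scale_eq_top [Fintype A] [Nonempty A] [Nontrivial A] {g : ℕ → ℝ≥0}
    (hg : AntitoneOn g (Set.Ici 1)) (hsum : Φ.volumeSum g Φ.similarityDim = ∞) :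
    ∑' k : ℕ, ENNReal.ofReal (4 ^ k * min ((g (2 ^ (k + 3)) /
      (4 * (Metric.diam Φ.selfSimilarSet + 1))) ^ Φ.similarityDim) ((4 ^ k)⁻¹)) = ∞ := by
  set D := Metric.diam Φ.selfSimilarSet
  have hD : 0 ≤ D := Metric.diam_nonneg
  set δ := Φ.similarityDim
  have hδ : 0 < δ := Φ.similarityDim_pos
  set H : ℕ → ℝ≥0∞ := fun n => ENNReal.ofReal ((g n / (4 * (D + 1))) ^ δ)
  have hH : AntitoneOn H (Set.Ici 1) := by
    intro m hm n hn hmn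
    have h1 : (g n : ℝ) ≤ g m := by exact_mod_cast hg hm hn hmn
    refine ENNReal.ofReal_le_ofReal (Real.rpow_le_rpow (by positivity) ?_ hδ.le)
    gcongr
  have h1 : ∑' n : ℕ, n * H n = ∞ := by
    by_contra h
    rw [volumeSum_similarityDim] at hsum
    refine ENNReal.mul_ne_top (a := ENNReal.ofReal ((4 * (D + 1) * D) ^ δ))
      ENNReal.ofReal_ne_top h ?_
    rw [← hsum, ← ENNReal.tsum_mul_left]
    refine tsum_congr fun n => ?_
    rw [mul_left_comm, ← ENNReal.ofReal_mul (by positivity),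
      ← Real.mul_rpow (by positivity) (by positivity)]
    congr 3
    change 4 * (D + 1) * D * (g n / (4 * (D + 1))) = D * g n
    field_simp
  have h2 := BernoulliShift.tsum_four_pow_mul_eq_top hH h1
  have h3 : ∑' k : ℕ, 4 ^ k * H (2 ^ (k + 3)) = ∞ := by
    rw [← ENNReal.summable.sum_add_tsum_nat_add' (f := fun k => 4 ^ k * H (2 ^ k)) (k := 3),
      ENNReal.add_eq_top] at h2
    have h4 : ∑' k : ℕ, 4 ^ (k + 3) * H (2 ^ (k + 3)) = ∞ := h2.resolve_left
      (ENNReal.sum_ne_top.2 fun k _ => ENNReal.mul_ne_top (by simp) ENNReal.ofReal_ne_top)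
    by_contra h
    refine ENNReal.mul_ne_top (a := 4 ^ 3) (by simp) h ?_
    rw [← h4, ← ENNReal.tsum_mul_left]
    exact tsum_congr fun k => by ring
  have h5 := BernoulliShift.tsum_min_one_eq_top
    (fun k => ENNReal.mul_ne_top (by simp) ENNReal.ofReal_ne_top) h3
  rw [← h5]
  refine tsum_congr fun k => ?_
  have h4k : (4 : ℝ≥0∞) ^ k = ENNReal.ofReal (4 ^ k) := by
    rw [ENNReal.ofReal_pow (by norm_num), ENNReal.ofReal_ofNat]
  rw [mul_min_of_nonneg _ _ (by positivity), mul_inv_cancel₀ (by positivity), ENNReal.ofReal_min,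
    ENNReal.ofReal_mul (by positivity), ENNReal.ofReal_one, h4k]

theorem selfSimilarMeasure_approximableSet_eq_one [Fintype A] [Nonempty A] [Nontrivial A]
    (hΦ : Φ.StrongSeparation) {g : ℕ → ℝ≥0} (hg : AntitoneOn g (Set.Ici 1))
    (hsum : Φ.volumeSum g Φ.similarityDim = ∞) :
    Φ.selfSimilarMeasure (Φ.approximableSet g) = 1 := by
  let : MeasurableSpace A := ⊤
  set δ := Φ.similarityDim
  have hδ : 0 < δ := Φ.similarityDim_pos
  set D := Metric.diam Φ.selfSimilarSet
  have hD : 0 ≤ D := Metric.diam_nonneg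
  set ν : Measure A := Φ.probPMF.toMeasure
  have hν : ∀ a, ν.real {a} = Φ.prob a := by
    intro a
    rw [Measure.real, PMF.toMeasure_apply_singleton _ _ (MeasurableSet.of_discrete)]
    exact ENNReal.toReal_ofReal (Φ.prob_pos a).le
  obtain ⟨a₀, ha₀⟩ := Finite.exists_min Φ.prob
  have hκ : ∀ a, Φ.prob a₀ ≤ ν.real {a} := fun a => (ha₀ a).trans (hν a).ge
  set ρ : ℝ := (1 / 2) ^ δ
  have hρ1 : ρ < 1 := Real.rpow_lt_one (by norm_num) (by norm_num) hδ
  have hρ0 : 0 < ρ := by positivity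
  have hρ : ∀ a, ν.real {a} ≤ ρ := fun a => (hν a).le.trans
    (Real.rpow_le_rpow (Φ.ratio_pos a).le (Φ.ratio_le_half a) hδ.le)
  set ε : ℕ → ℝ := fun k => min ((g (2 ^ (k + 3)) / (4 * (D + 1))) ^ δ) ((4 ^ k)⁻¹)
  have hε0 : ∀ k, 0 ≤ ε k := fun k => le_min (by positivity) (by positivity)
  have hε1 : ∀ k, 4 ^ k * ε k ≤ 1 := fun k => by
    rw [← mul_inv_cancel₀ (pow_ne_zero k (four_ne_zero (α := ℝ)))]
    exact mul_le_mul_of_nonneg_left (min_le_right _ _) (by positivity)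
  have hret := BernoulliShift.ae_frequently_mem_recurrenceSet ν (Φ.prob_pos a₀) hρ1 hκ hρ hε0 hε1
    (Φ.tsum_four_pow_mul_scale_eq_top hg hsum)
  have hirr : ∀ᵐ a ∂BernoulliShift.bernoulliMeasure ν, ∀ i, Φ.periodicPoint i ≠ Φ.coding a := by
    refine ae_all_iff.2 fun i => measure_mono_null (t := {eventuallyPeriodic i.2.1 i.2.2}) ?_
      (BernoulliShift.measure_singleton_eq_zero ν hρ1 hρ _)
    intro a ha
    exact (Φ.coding_injective hΦ (not_not.1 ha)).symm
  have hae : ∀ᵐ a ∂BernoulliShift.bernoulliMeasure ν, Φ.coding a ∈ Φ.approximableSet g := by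
    filter_upwards [hret, hirr] with a ha hai
    refine Φ.coding_mem_approximableSet hai fun N => ?_
    obtain ⟨k, hNk, hk, l, hl, n, hn, hw⟩ := frequently_atTop.1 ha N
    have hkpow : k < 2 ^ k := Nat.lt_two_pow_self
    rw [BernoulliShift.stopWord,
      BernoulliShift.stoppingWord_eq_iff (fun a => measureReal_nonneg) hρ hk] at hw
    have hweight := BernoulliShift.stoppingTime_spec (p := fun a => ν.real {a})
      (fun a => measureReal_nonneg) hρ hk fun i => a (4 * 2 ^ k + 2 * 2 ^ k + n + i)
    set n' := 4 * 2 ^ k + 2 * 2 ^ k + n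
    set t := BernoulliShift.stoppingTime (fun a => ν.real {a}) (ε k) fun i => a (n' + i)
    have hgpos : (0 : ℝ) < g (2 ^ (k + 3)) := by
      refine (NNReal.coe_nonneg _).lt_of_ne fun h0 => ?_
      have : 0 < ε k := (pow_pos hρ0 _).trans_le hk
      have h2 := this.trans_le (min_le_left _ _)
      rw [← h0, zero_div, Real.zero_rpow hδ.ne'] at h2
      exact lt_irrefl _ h2
    have hgle : g (2 ^ (k + 3)) ≤ g n' := by
      have h8 : 2 ^ (k + 3) = 8 * 2 ^ k := by ring
      refine hg ?_ ?_ ?_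
      · rw [Set.mem_Ici]
        omega
      · exact Nat.one_le_two_pow
      · omega
    -- `π(a)` is approximated by repeating the letters of `a` between the two equal words.
    refine ⟨n', by omega, ⟨4 * 2 ^ k + l, by omega⟩,
      Φ.norm_sub_lt_of_return hg _ (t := t) hw (lt_of_lt_of_le (by exact_mod_cast hgpos) hgle) ?_⟩
    have hR : 0 ≤ ∏ i ∈ Finset.range t, Φ.ratio (a (n' + i)) :=
      Finset.prod_nonneg fun i _ => (Φ.ratio_pos _).le
    simp only [hν] at hweight
    rw [Φ.prod_prob_eq] at hweight
    have h3 := (Real.rpow_le_rpow_iff hR (by positivity) hδ).1 (hweight.trans (min_le_left _ _))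
    refine h3.trans ?_
    gcongr
  rw [selfSimilarMeasure, (Φ.measurableEmbedding_coding hΦ).map_apply]
  exact (measure_congr (eventuallyEq_univ.2 hae)).trans
    (measure_univ (μ := BernoulliShift.bernoulliMeasure ν))

end Divergence

end RationalIFS

/-- Khintchine-type theorem for intrinsic approximation on a self-similar set with the strong
separation condition. -/
theorem theorem2p6 {A : Type*} [Fintype A] [Nonempty A] {d : ℕ} (Φ : RationalIFS A d)
    (hΦ : Φ.StrongSeparation) (g : ℕ → ℝ≥0) :
    (∀ s : ℝ, 0 ≤ s → Φ.volumeSum g s < ∞ → μH[s] (Φ.approximableSet g) = 0) ∧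
    (AntitoneOn g (Set.Ici 1) →
      Φ.entropy < -2 * Real.log (∑ a, Φ.prob a ^ 2) →
      Φ.volumeSum g Φ.similarityDim = ∞ →
      Φ.selfSimilarMeasure (Φ.approximableSet g) = 1) := by
  refine ⟨fun s hs hsum => Φ.hausdorffMeasure_approximableSet_eq_zero hΦ g hs hsum,
    fun hg hent hsum => ?_⟩
  have := Φ.nontrivial_of_entropy_lt hent
  exact Φ.selfSimilarMeasure_approximableSet_eq_one hΦ hg hsum
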